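/- Let $\alpha>-\tfrac12$ and $b>0$. Let $\mathcal{E}(\mathbb{R})$ be the space of infinitely differentiable functions $\mathbb{R}\to\mathbb{C}$, with the topology of uniform convergence of all derivatives on compact sets, and let $\mathcal{E}'(\mathbb{R})$ be its dual, the space of (complex) distributions on $\mathbb{R}$ with compact support. For $\mu\in\mathbb{C}$ and $x\in\mathbb{R}$ let $$S^\alpha_\mu(x)=j_\alpha(i\mu x)-i\,h_\alpha(i\mu x)$$ be the Bessel–Struve kernel, where $$j_\alpha(z)=\Gamma(\alpha+1)\sum_{n\ge 0}\frac{(-1)^n(z/2)^{2n}}{n!\,\Gamma(n+\alpha+1)},\qquad h_\alpha(z)=\Gamma(\alpha+1)\sum_{n\ge 0}\frac{(-1)^n(z/2)^{2n+1}}{\Gamma(n+\frac32)\,\Gamma(n+\alpha+\frac32)}$$ are the normalized Bessel and Struve functions. The Bessel–Struve transform of $T\in\mathcal{E}'(\mathbb{R})$ is the function $$\mathcal{F}^\alpha_{B,S}(T)(\lambda)=\langle T,\,S^\alpha_{-i\lambda}\rangle,\qquad \lambda\in\mathbb{R}.$$ Let $f\in\mathcal{E}(\mathbb{R})$. Then the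 following two assertions are equivalent: 1. There exists a distribution $T\in\mathcal{E}'(\mathbb{R})$ with support included in $[-b,b]$ such that $f=\mathcal{F}^\alpha_{B,S}(T)$. 2. $f$ extends to an entire function $\tilde f$ on $\mathbb{C}$ for which there exist $m\in\mathbb{N}$ and $c>0$ such that $$|\tilde f(z)|\le c\,(1+|z|^2)^{m/2}\,e^{b|\operatorname{Im} z|}\qquad\text{for all } z\in\mathbb{C}.$$ -/

import Mathlib

open scoped ContDiff Topology

noncomputable section

namespace BesselStruve

/-! ### The space of smooth functions on the line and its dual -/

/-- The complex subspace of infinitely differentiable functions `ℝ → ℂ`. -/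
def smoothSubmodule : Submodule ℂ (ℝ → ℂ) where
  carrier := {f | ContDiff ℝ ∞ f}
  zero_mem' := by
    rw [Set.mem_ofPred_eq]
    exact contDiff_const
  add_mem' hf hg := by
    rw [Set.mem_ofPred_eq] at *
    exact hf.add hg
  smul_mem' c _ hf := by
    rw [Set.mem_ofPred_eq] at *
    exact hf.const_smul c

/-- The space `ℰ(ℝ)` of complex-valued infinitely differentiable functions on `ℝ`. It is a
type of its own, so that it does not inherit the topology of pointwise convergence. -/
def SmoothSpace : Type := smoothSubmodule

namespace SmoothSpace

instance : AddCommGroup SmoothSpace := inferInstanceAs (AddCommGroup smoothSubmodule)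

instance : Module ℂ SmoothSpace := inferInstanceAs (Module ℂ smoothSubmodule)

instance : FunLike SmoothSpace ℝ ℂ where
  coe f := f.1
  coe_injective _ _ h := Subtype.ext h

/-- A smooth function, as an element of `ℰ(ℝ)`. -/
def mk (f : ℝ → ℂ) (hf : ContDiff ℝ ∞ f) : SmoothSpace := ⟨f, hf⟩

@[simp] theorem mk_apply (f : ℝ → ℂ) (hf : ContDiff ℝ ∞ f) (x : ℝ) : mk f hf x = f x := rfl

theorem contDiff (f : SmoothSpace) : ContDiff ℝ ∞ f := f.2

theorem coe_add (f g : SmoothSpace) : ⇑(f + g) = ⇑f + ⇑g := rfl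

theorem coe_smul (c : ℂ) (f : SmoothSpace) : ⇑(c • f) = c • ⇑f := rfl

theorem bddAbove_norm_iteratedDeriv (k n : ℕ) (f : SmoothSpace) :
    BddAbove (Set.range fun x : Set.Icc (-(k : ℝ)) k => ‖iteratedDeriv n f x‖) := by
  have hc : Continuous fun x : ℝ => ‖iteratedDeriv n f x‖ :=
    (f.contDiff.continuous_iteratedDeriv n (by exact_mod_cast le_top)).norm
  have := (isCompact_Icc (a := -(k : ℝ)) (b := k)).bddAbove_image hc.continuousOn
  refine this.mono ?_
  rintro _ ⟨x, rfl⟩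
  exact ⟨x, x.2, rfl⟩

/-- The seminorm `f ↦ sup_{|x| ≤ k} |f⁽ⁿ⁾(x)|` on `ℰ(ℝ)`. -/
def supSeminorm (k n : ℕ) : Seminorm ℂ SmoothSpace :=
  Seminorm.of (fun f => ⨆ x : Set.Icc (-(k : ℝ)) k, ‖iteratedDeriv n f x‖)
    (by
      intro f g
      have : Nonempty (Set.Icc (-(k : ℝ)) k) := ⟨⟨0, by simp⟩⟩
      refine ciSup_le fun x => ?_
      have h : iteratedDeriv n (⇑(f + g)) (x : ℝ)
          = iteratedDeriv n f (x : ℝ) + iteratedDeriv n g (x : ℝ) := by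
        rw [coe_add]
        exact iteratedDeriv_add
          ((f.contDiff.of_le (by exact_mod_cast le_top)).contDiffAt)
          ((g.contDiff.of_le (by exact_mod_cast le_top)).contDiffAt)
      rw [h]
      exact (norm_add_le _ _).trans (add_le_add
        (le_ciSup (bddAbove_norm_iteratedDeriv k n f) x)
        (le_ciSup (bddAbove_norm_iteratedDeriv k n g) x)))
    (by
      intro c f
      rw [Real.mul_iSup_of_nonneg (norm_nonneg c)]
      refine iSup_congr fun x => ?_
      rw [coe_smul, iteratedDeriv_const_smul_field]
      simp)

theorem supSeminorm_apply (k n : ℕ) (f : SmoothSpace) :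
    supSeminorm k n f = ⨆ x : Set.Icc (-(k : ℝ)) k, ‖iteratedDeriv n f x‖ := rfl

/-- The family of all seminorms `sup_{|x| ≤ k} |f⁽ⁿ⁾(x)|`, indexed by the pairs `(k, n)`. -/
def seminormFamily : SeminormFamily ℂ SmoothSpace (ℕ × ℕ) := fun p => supSeminorm p.1 p.2

/-- The usual Fréchet topology of `ℰ(ℝ)`: uniform convergence on compact sets of all
derivatives. -/
instance : TopologicalSpace SmoothSpace := seminormFamily.moduleFilterBasis.topology

theorem withSeminorms : WithSeminorms seminormFamily := ⟨rfl⟩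

instance : IsTopologicalAddGroup SmoothSpace := withSeminorms.topologicalAddGroup

instance : ContinuousSMul ℂ SmoothSpace := withSeminorms.continuousSMul

end SmoothSpace

/-- The space `ℰ'(ℝ)` of distributions with compact support: the continuous linear forms
on `ℰ(ℝ)`. -/
abbrev CompactDistribution : Type := SmoothSpace →L[ℂ] ℂ

/-! ### The Bessel–Struve kernel -/

/-- The normalized Bessel function
`j_α(z) = Γ(α+1) ∑ (-1)ⁿ (z/2)²ⁿ / (n! Γ(n+α+1))`. -/
def normalizedBessel (α : ℝ) (z : ℂ) : ℂ :=
  (Real.Gamma (α + 1) : ℂ) *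
    ∑' n : ℕ, (-1) ^ n * (z / 2) ^ (2 * n) / ((n.factorial : ℂ) * (Real.Gamma (n + α + 1) : ℂ))

/-- The normalized Struve function
`h_α(z) = Γ(α+1) ∑ (-1)ⁿ (z/2)²ⁿ⁺¹ / (Γ(n+3/2) Γ(n+α+3/2))`. -/
def normalizedStruve (α : ℝ) (z : ℂ) : ℂ :=
  (Real.Gamma (α + 1) : ℂ) *
    ∑' n : ℕ, (-1) ^ n * (z / 2) ^ (2 * n + 1) /
      ((Real.Gamma (n + 3 / 2) : ℂ) * (Real.Gamma (n + α + 3 / 2) : ℂ))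

/-- The Bessel–Struve kernel `S^α_μ(x) = j_α(iμx) - i h_α(iμx)`. -/
def kernel (α : ℝ) (μ : ℂ) (x : ℝ) : ℂ :=
  normalizedBessel α (Complex.I * μ * x) - Complex.I * normalizedStruve α (Complex.I * μ * x)

theorem summable_gamma (c d r : ℝ) (hr : 0 < r) :
    Summable fun n : ℕ => r ^ n / (Real.Gamma (n + c) * Real.Gamma (n + d)) := by
  have hpos : ∀ e : ℝ, ∀ᶠ n : ℕ in Filter.atTop, 0 < (n : ℝ) + e := fun e =>
    (Filter.tendsto_atTop_add_const_right _ e tendsto_natCast_atTop_atTop).eventually_gt_atTop 0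
  refine summable_of_ratio_test_tendsto_lt_one (l := 0) zero_lt_one ?_ ?_
  · filter_upwards [hpos c, hpos d] with n hc hd
    have := Real.Gamma_pos_of_pos hc
    have := Real.Gamma_pos_of_pos hd
    positivity
  · have h : Filter.Tendsto (fun n : ℕ => r / (((n : ℝ) + c) * ((n : ℝ) + d))) Filter.atTop (𝓝 0) :=
      Filter.Tendsto.div_atTop tendsto_const_nhds
        ((Filter.tendsto_atTop_add_const_right _ c tendsto_natCast_atTop_atTop).atTop_mul_atTop₀
          (Filter.tendsto_atTop_add_const_right _ d tendsto_natCast_atTop_atTop))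
    refine h.congr' ?_
    filter_upwards [hpos c, hpos d] with n hc hd
    have h1 := Real.Gamma_pos_of_pos hc
    have h2 := Real.Gamma_pos_of_pos hd
    have e1 : Real.Gamma (((n + 1 : ℕ) : ℝ) + c) = (n + c) * Real.Gamma (n + c) := by
      rw [← Real.Gamma_add_one hc.ne']; push_cast; ring_nf
    have e2 : Real.Gamma (((n + 1 : ℕ) : ℝ) + d) = (n + d) * Real.Gamma (n + d) := by
      rw [← Real.Gamma_add_one hd.ne']; push_cast; ring_nf
    rw [e1, e2, Real.norm_of_nonneg (by positivity), Real.norm_of_nonneg (by positivity)]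
    field_simp
    ring

theorem differentiable_gammaSeries (c d : ℝ) : Differentiable ℂ fun w : ℂ =>
    ∑' n : ℕ, w ^ n / ((Real.Gamma (n + c) : ℂ) * (Real.Gamma (n + d) : ℂ)) := by
  intro w
  have hR : 0 < ‖w‖ + 1 := by positivity
  refine (Complex.differentiableOn_tsum_of_summable_norm (summable_gamma c d _ hR).norm
    (fun n => ?_) Metric.isOpen_ball (fun n z hz => ?_)).differentiableAt
    (Metric.isOpen_ball.mem_nhds (x := w) (s := Metric.ball (0 : ℂ) (‖w‖ + 1)) (by simp))
  · exact ((differentiable_id.pow n).div_const _).differentiableOn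
  · have hz' : ‖z‖ ≤ ‖w‖ + 1 := (mem_ball_zero_iff.mp hz).le
    simp only [norm_div, norm_mul, norm_pow, Complex.norm_real]
    rw [Real.norm_of_nonneg hR.le]
    gcongr

theorem differentiable_normalizedBessel (α : ℝ) : Differentiable ℂ (normalizedBessel α) := by
  have h := ((differentiable_gammaSeries 1 (α + 1)).comp
    (g := _) (f := fun z : ℂ => -(z / 2) ^ 2) (by fun_prop)).const_mul (Real.Gamma (α + 1) : ℂ)
  refine (congrArg (Differentiable ℂ) ?_).mpr h
  funext z
  simp only [normalizedBessel, Function.comp]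
  congr 1
  refine tsum_congr fun n => ?_
  rw [Real.Gamma_nat_eq_factorial, add_assoc, neg_pow ((z / 2) ^ 2), ← pow_mul]
  simp

theorem differentiable_normalizedStruve (α : ℝ) : Differentiable ℂ (normalizedStruve α) := by
  have h := (((differentiable_gammaSeries (3 / 2) (α + 3 / 2)).comp
    (g := _) (f := fun z : ℂ => -(z / 2) ^ 2) (by fun_prop)).fun_mul
      (differentiable_id.div_const 2)).const_mul (Real.Gamma (α + 1) : ℂ)
  refine (congrArg (Differentiable ℂ) ?_).mpr h
  funext z
  simp only [normalizedStruve, Function.comp, id]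
  congr 1
  rw [← tsum_mul_right]
  refine tsum_congr fun n => ?_
  rw [add_assoc, neg_pow (((z / 2) ^ 2)), ← pow_mul, pow_succ]
  ring

theorem contDiff_kernel (α : ℝ) (μ : ℂ) : ContDiff ℝ ∞ (kernel α μ) := by
  have hl : ContDiff ℝ ∞ fun x : ℝ => Complex.I * μ * (x : ℂ) :=
    contDiff_const.mul Complex.ofRealCLM.contDiff
  have hj : ContDiff ℝ ∞ (normalizedBessel α) :=
    (differentiable_normalizedBessel α).contDiff.restrict_scalars ℝ
  have hh : ContDiff ℝ ∞ (normalizedStruve α) :=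
    (differentiable_normalizedStruve α).contDiff.restrict_scalars ℝ
  exact (hj.comp hl).sub (contDiff_const.mul (hh.comp hl))

/-- The Bessel–Struve kernel `x ↦ S^α_μ(x)`, as an element of `ℰ(ℝ)`. -/
def smoothKernel (α : ℝ) (μ : ℂ) : SmoothSpace := SmoothSpace.mk (kernel α μ) (contDiff_kernel α μ)

/-- The Bessel–Struve transform of a distribution with compact support:
`ℱ(T)(lam) = ⟨T, S^α_{-i lam}⟩` for real `lam`. -/
def transform (α : ℝ) (T : CompactDistribution) (lam : ℝ) : ℂ :=
  T (smoothKernel α (-Complex.I * lam))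

end BesselStruve

end

/-!
Write `S_μ(x) = φ(μ x)`. The duplication formula for the Gamma function turns the Bessel and Struve
series into `φ(y) = ∑ cₙ yⁿ / n!`, where `cₙ` is the `n`-th moment of the square root of a
`Beta(1/2, α + 1/2)` variable `W`; hence `φ(y) = E[exp(y W)]` and `|φ(y)| ≤ exp |Re y|`
(`kernelProfile_eq_integral`, `norm_kernelProfile_le`). A distribution may be applied term by term
to the power series of an entire function (`hasSum_apply_dilation`), so that
`⟨T, S_{-iz}⟩ = ∑ cₙ (-iz)ⁿ ⟨T, xⁿ⟩ / n!` for all complex `z`. In particular this is an entire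
extension of the transform of `T`, and it depends only on the moments of `T`.

For the growth estimate, the test function is multiplied by a cut-off function that is `1` near
`[-b, b]` and vanishes at distance `2/(1+|z|)` from it. A distribution supported in `[-b, b]` does
not see the cut-off, and the continuity of `T` together with Cauchy's estimate for `φ` gives
`C (1+|z|)ᴺ exp(b|Im z|)` (`exists_norm_apply_dilation_le`).

For the converse, let `F` be entire with the stated bound. A distribution supported in `[-b, b]`
with the moments `iⁿ F⁽ⁿ⁾(0) / cₙ` is needed. Beta integrals invert the numbers `cₙ`: for a natural
number `k > α + 1/2`, the product of `cₙ`, of the moments `eₙ` of the square root of a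
`Beta(α + 1, k - α - 1/2)` variable, and of the polynomial `Q(n) = ∏_{j<k} (n/2 + 1/2 + j)` does not
depend on `n` (`beta_ratio_mul_beta_ratio_mul_prod`). The polynomial is absorbed into `F`: the
function `H` with Taylor coefficients multiplied by `Q(n)` arises from `F` by a polynomial in the
Euler operator `z d/dz`, which respects the Paley–Wiener type (`exists_prod_mul_iteratedDeriv`). It
remains to realize the moments `eₙ iⁿ H⁽ⁿ⁾(0)`. If `H` decays like `|z|⁻²`, contour shift and
Fourier inversion give `H(z) = ∫ g(x) e^{-izx} dx` with a continuous `g` supported in `[-b, b]`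
(`exists_density`), and `f ↦ E[∫ g(x) f(x W') dx]` does it, `W'` being the variable with the moments
`eₙ`. The general case is an induction on the order of growth, in which a multiple of
`(sin(bz/2)/z)²` is subtracted, the remainder is divided by `z`, and this division is compensated by
a derivative of the test function (`representsMoments_of_paleyWienerBound`).
-/

open scoped ContDiff Topology

noncomputable section

namespace BesselStruve

open MeasureTheory Filter

/-! ### Seminorm bounds and basic operations on `ℰ(ℝ)` -/

namespace SmoothSpace

@[ext] theorem ext {f g : SmoothSpace} (h : ∀ x, f x = g x) : f = g := DFunLike.ext _ _ h

@[simp] theorem add_apply (f g : SmoothSpace) (x : ℝ) : (f + g) x = f x + g x := rfl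

@[simp] theorem smul_apply (c : ℂ) (f : SmoothSpace) (x : ℝ) : (c • f) x = c * f x := rfl

@[simp] theorem sub_apply (f g : SmoothSpace) (x : ℝ) : (f - g) x = f x - g x := rfl

@[simp] theorem sum_apply {ι : Type*} (s : Finset ι) (f : ι → SmoothSpace) (x : ℝ) :
    (∑ i ∈ s, f i) x = ∑ i ∈ s, f i x := by
  classical
  induction s using Finset.induction_on with
  | empty => rfl
  | insert i s hi ih => rw [Finset.sum_insert hi, Finset.sum_insert hi, add_apply, ih]

theorem norm_iteratedDeriv_le_supSeminorm {k : ℕ} (n : ℕ) (f : SmoothSpace) {x : ℝ}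
    (hx : |x| ≤ k) : ‖iteratedDeriv n f x‖ ≤ supSeminorm k n f :=
  le_ciSup (bddAbove_norm_iteratedDeriv k n f) ⟨x, abs_le.mp hx⟩

theorem supSeminorm_le {k n : ℕ} {f : SmoothSpace} {B : ℝ}
    (h : ∀ x : ℝ, |x| ≤ k → ‖iteratedDeriv n f x‖ ≤ B) : supSeminorm k n f ≤ B := by
  have : Nonempty (Set.Icc (-(k : ℝ)) k) := ⟨⟨0, by simp⟩⟩
  exact ciSup_le fun x => h x (abs_le.mpr x.2)

/-- A compactly supported distribution has finite order, and is controlled on a single compact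
interval. -/
theorem exists_bound (T : CompactDistribution) : ∃ K N : ℕ, ∃ C : ℝ, 0 ≤ C ∧
    ∀ (f : SmoothSpace) (B : ℝ), 0 ≤ B →
      (∀ n ≤ N, ∀ x : ℝ, |x| ≤ K → ‖iteratedDeriv n f x‖ ≤ B) → ‖T f‖ ≤ C * B := by
  obtain ⟨s, C, -, hC⟩ := Seminorm.bound_of_continuous withSeminorms
    ((normSeminorm ℂ ℂ).comp (T : SmoothSpace →ₗ[ℂ] ℂ)) (by
      change Continuous fun f => ‖T f‖
      exact T.continuous.norm)
  refine ⟨s.sup Prod.fst, s.sup Prod.snd, C, C.2, fun f B hB h => ?_⟩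
  have h1 : ‖T f‖ ≤ C * (s.sup seminormFamily) f := hC f
  refine h1.trans (mul_le_mul_of_nonneg_left ?_ C.2)
  refine Seminorm.finset_sup_apply_le hB fun p hp => supSeminorm_le fun x hx => ?_
  refine h p.2 (Finset.le_sup (f := Prod.snd) hp) x (hx.trans ?_)
  exact_mod_cast Finset.le_sup (f := Prod.fst) hp

/-- The derivative, as a continuous endomorphism of `ℰ(ℝ)`. -/
def derivCLM : SmoothSpace →L[ℂ] SmoothSpace :=
  let L : SmoothSpace →ₗ[ℂ] SmoothSpace :=
    { toFun := fun f => mk (deriv f) (contDiff_infty_iff_deriv.mp f.contDiff).2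
      map_add' := fun f g => by
        ext x
        exact deriv_add (f.contDiff.differentiable (by simp) x)
          (g.contDiff.differentiable (by simp) x)
      map_smul' := fun c f => by
        ext x
        exact deriv_const_smul c (f.contDiff.differentiable (by simp) x) }
  ⟨L, by
    refine withSeminorms.continuous_of_isBounded withSeminorms L fun p =>
      ⟨{(p.1, p.2 + 1)}, 1, fun f => ?_⟩
    simp only [Finset.sup_singleton, one_smul]
    refine supSeminorm_le fun x hx => ?_
    have : iteratedDeriv p.2 (deriv f) x = iteratedDeriv (p.2 + 1) f x := by
      rw [iteratedDeriv_succ']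
    exact (congrArg norm this).trans_le (norm_iteratedDeriv_le_supSeminorm _ f hx)⟩

@[simp] theorem derivCLM_apply (f : SmoothSpace) (x : ℝ) : derivCLM f x = deriv f x := rfl

/-- The monomial `x ↦ xⁿ`. -/
def monomial (n : ℕ) : SmoothSpace := mk (fun x => (x : ℂ) ^ n) (Complex.ofRealCLM.contDiff.pow n)

@[simp] theorem monomial_apply (n : ℕ) (x : ℝ) : monomial n x = (x : ℂ) ^ n := rfl

theorem derivCLM_monomial (n : ℕ) : derivCLM (monomial n) = (n : ℂ) • monomial (n - 1) := by
  ext x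
  have := ((hasDerivAt_id x).ofReal_comp.fun_pow n).deriv
  rw [derivCLM_apply, smul_apply, monomial_apply]
  exact this.trans (by simp)

/-- The distribution `f ↦ ∫ h(p) f(q(p)) dν(p)`, for an integrable density `h` and a bounded
measurable map `q` to the line. -/
def integralDistribution {X : Type*} [MeasurableSpace X] (ν : Measure X) (h : X → ℂ)
    (hh : Integrable h ν) (q : X → ℝ) (hq : Measurable q) (b : ℝ) (hb : ∀ᵐ p ∂ν, |q p| ≤ b) :
    CompactDistribution :=
  have hbd : ∀ f : SmoothSpace, ∀ᵐ p ∂ν, ‖f (q p)‖ ≤ supSeminorm ⌈b⌉₊ 0 f := fun f => by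
    filter_upwards [hb] with p hp
    simpa using norm_iteratedDeriv_le_supSeminorm 0 f (hp.trans (Nat.le_ceil b))
  have hint : ∀ f : SmoothSpace, Integrable (fun p => h p * f (q p)) ν := fun f =>
    hh.mul_bdd (f.contDiff.continuous.measurable.comp hq).aestronglyMeasurable (hbd f)
  let L : SmoothSpace →ₗ[ℂ] ℂ :=
    { toFun := fun f => ∫ p, h p * f (q p) ∂ν
      map_add' := fun f g => by
        simp only [add_apply, mul_add]
        exact integral_add (hint f) (hint g)
      map_smul' := fun c f => by
        simp only [smul_apply, mul_left_comm _ c, RingHom.id_apply, smul_eq_mul]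
        exact integral_const_mul _ _ }
  ⟨L, by
    refine withSeminorms.continuous_normedSpace_rng ℂ L
      ⟨{(⌈b⌉₊, 0)}, (∫ p, ‖h p‖ ∂ν).toNNReal, fun f => ?_⟩
    simp only [Finset.sup_singleton]
    change ‖∫ p, h p * f (q p) ∂ν‖ ≤ (∫ p, ‖h p‖ ∂ν).toNNReal * supSeminorm ⌈b⌉₊ 0 f
    rw [Real.coe_toNNReal _ (integral_nonneg fun _ => norm_nonneg _), ← integral_mul_const]
    refine norm_integral_le_of_norm_le (hh.norm.mul_const _) ?_
    filter_upwards [hbd f] with p hp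
    rw [norm_mul]
    gcongr⟩

theorem integralDistribution_apply {X : Type*} [MeasurableSpace X] (ν : Measure X) (h : X → ℂ)
    (hh : Integrable h ν) (q : X → ℝ) (hq : Measurable q) (b : ℝ) (hb : ∀ᵐ p ∂ν, |q p| ≤ b)
    (f : SmoothSpace) :
    integralDistribution ν h hh q hq b hb f = ∫ p, h p * f (q p) ∂ν := rfl

end SmoothSpace

open SmoothSpace

/-- The function `x ↦ φ(μ x)` on the line, for an entire function `φ`. -/
def dilation (φ : ℂ → ℂ) (hφ : Differentiable ℂ φ) (μ : ℂ) : SmoothSpace :=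
  mk (fun x => φ (μ * x)) (by
    have hl : ContDiff ℝ ∞ fun x : ℝ => μ * (x : ℂ) :=
      contDiff_const.mul Complex.ofRealCLM.contDiff
    exact (hφ.contDiff.restrict_scalars ℝ).comp hl)

@[simp] theorem dilation_apply (φ : ℂ → ℂ) (hφ : Differentiable ℂ φ) (μ : ℂ) (x : ℝ) :
    dilation φ hφ μ x = φ (μ * x) := rfl

theorem iteratedDeriv_comp_mul_ofReal {φ : ℂ → ℂ} (hφ : Differentiable ℂ φ) (μ : ℂ) (n : ℕ) :
    iteratedDeriv n (fun x : ℝ => φ (μ * x)) = fun x : ℝ => μ ^ n * iteratedDeriv n φ (μ * x) := by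
  induction n with
  | zero => simp
  | succ n ih =>
    rw [iteratedDeriv_succ, ih]
    funext x
    have h1 : HasDerivAt (iteratedDeriv n φ) (iteratedDeriv (n + 1) φ (μ * x)) (μ * x) := by
      rw [iteratedDeriv_succ]
      exact (hφ.contDiff.differentiable_iteratedDeriv n (WithTop.coe_lt_top _) _).hasDerivAt
    have h2 : HasDerivAt (fun z : ℂ => μ * z) μ (x : ℂ) := by
      simpa using (hasDerivAt_id (x : ℂ)).const_mul μ
    have := (((h1.comp (x : ℂ) h2).comp_ofReal).const_mul (μ ^ n)).deriv
    simp only [Function.comp_def] at this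
    rw [this, pow_succ]
    ring

/-- Cauchy's estimate on a unit circle. -/
theorem norm_iteratedDeriv_le_of_unit_sphere {φ : ℂ → ℂ} (hφ : Differentiable ℂ φ) (n : ℕ) (c : ℂ)
    {B : ℝ} (hB : ∀ z ∈ Metric.sphere c 1, ‖φ z‖ ≤ B) :
    ‖iteratedDeriv n φ c‖ ≤ n.factorial * B := by
  simpa using Complex.norm_iteratedDeriv_le_of_forall_mem_sphere_norm_le n one_pos
    hφ.diffContOnCl hB

theorem summable_of_forall_hasSum {φ : ℂ → ℂ} {a : ℕ → ℂ}
    (h : ∀ y, HasSum (fun n => a n * y ^ n) (φ y)) (R : ℝ) : Summable fun n => ‖a n‖ * |R| ^ n := by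
  simpa [norm_mul, norm_pow] using (h R).summable.norm

theorem differentiable_of_forall_hasSum {φ : ℂ → ℂ} {a : ℕ → ℂ}
    (h : ∀ y, HasSum (fun n => a n * y ^ n) (φ y)) : Differentiable ℂ φ := by
  have he : φ = fun y => ∑' n, a n * y ^ n := funext fun y => (h y).tsum_eq.symm
  intro w
  rw [he]
  refine (Complex.differentiableOn_tsum_of_summable_norm (summable_of_forall_hasSum h (‖w‖ + 1))
    (fun n => ?_) Metric.isOpen_ball (fun n z hz => ?_)).differentiableAt
    (Metric.isOpen_ball.mem_nhds (x := w) (s := Metric.ball (0 : ℂ) (‖w‖ + 1)) (by simp))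
  · exact ((differentiable_id.pow n).const_mul _).differentiableOn
  · rw [norm_mul, norm_pow, abs_of_nonneg (by positivity)]
    have hz' : ‖z‖ ≤ ‖w‖ + 1 := (mem_ball_zero_iff.mp hz).le
    gcongr

/-- A distribution may be applied term by term to the power series of an entire function. -/
theorem hasSum_apply_dilation (T : CompactDistribution) {φ : ℂ → ℂ} {a : ℕ → ℂ}
    (h : ∀ y, HasSum (fun n => a n * y ^ n) (φ y)) (hφ : Differentiable ℂ φ) (μ : ℂ) :
    HasSum (fun n => a n * μ ^ n * T (monomial n)) (T (dilation φ hφ μ)) := by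
  obtain ⟨K, N, C, hC, hT⟩ := exists_bound T
  set R : ℝ := ‖μ‖ * K + 1 with hR
  have hR0 : 0 ≤ R := by positivity
  have hunif : TendstoUniformlyOn (fun (s : Finset ℕ) y => ∑ n ∈ s, a n * y ^ n) φ atTop
      (Metric.closedBall 0 R) := by
    have := tendstoUniformlyOn_tsum (summable_of_forall_hasSum h R)
      (f := fun n y => a n * y ^ n) (s := Metric.closedBall (0 : ℂ) R) (fun n y hy => by
        rw [norm_mul, norm_pow, abs_of_nonneg hR0]
        have := mem_closedBall_zero_iff.mp hy
        gcongr)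
    refine this.congr_right fun y _ => (h y).tsum_eq
  rw [HasSum]
  have hsum : ∀ s : Finset ℕ, ∑ n ∈ s, a n * μ ^ n * T (monomial n)
      = T (∑ n ∈ s, (a n * μ ^ n) • monomial n) := fun s => by simp
  simp only [SummationFilter.unconditional_filter, hsum]
  rw [Metric.tendsto_nhds]
  intro ε hε
  set D : ℝ := C * ((max 1 (‖μ‖ ^ N)) * N.factorial) with hD
  have hD0 : 0 ≤ D := by positivity
  have hε' : 0 < ε / (D + 1) := by positivity
  filter_upwards [Metric.tendstoUniformlyOn_iff.mp hunif _ hε'] with s hs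
  have hd : Differentiable ℂ fun y => φ y - ∑ n ∈ s, a n * y ^ n := by fun_prop
  rw [dist_comm, dist_eq_norm, ← map_sub]
  have hb : ‖T (dilation φ hφ μ - ∑ n ∈ s, (a n * μ ^ n) • monomial n)‖ ≤
      C * (max 1 (‖μ‖ ^ N) * (N.factorial * (ε / (D + 1)))) := by
    refine hT _ _ (by positivity) fun n hn x hx => ?_
    have he : ⇑(dilation φ hφ μ - ∑ n ∈ s, (a n * μ ^ n) • monomial n)
        = fun x : ℝ => (fun y => φ y - ∑ n ∈ s, a n * y ^ n) (μ * x) := by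
      funext x
      simp [mul_pow, mul_assoc]
    rw [he, iteratedDeriv_comp_mul_ofReal hd, norm_mul, norm_pow]
    have h1 : ‖μ‖ ^ n ≤ max 1 (‖μ‖ ^ N) := by
      rcases le_total ‖μ‖ 1 with h1 | h1
      · exact le_max_of_le_left (pow_le_one₀ (norm_nonneg _) h1)
      · exact le_max_of_le_right (pow_le_pow_right₀ h1 hn)
    have h2 : ‖iteratedDeriv n (fun y => φ y - ∑ n ∈ s, a n * y ^ n) (μ * x)‖
        ≤ n.factorial * (ε / (D + 1)) := by
      refine norm_iteratedDeriv_le_of_unit_sphere hd n _ fun z hz => ?_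
      have := hs z (by
        rw [mem_closedBall_zero_iff, hR]
        have h3 : ‖z - μ * x‖ = 1 := by simpa [dist_eq_norm] using hz
        calc ‖z‖ = ‖μ * x + (z - μ * x)‖ := by congr 1; ring
          _ ≤ ‖μ * x‖ + ‖z - μ * x‖ := norm_add_le _ _
          _ ≤ ‖μ‖ * K + 1 := by
            rw [h3, norm_mul, Complex.norm_real, Real.norm_eq_abs]
            gcongr)
      rw [dist_eq_norm] at this
      exact this.le
    have h4 : (n.factorial : ℝ) ≤ N.factorial := by exact_mod_cast Nat.factorial_le hn
    gcongr
    exact h2.trans (by gcongr)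
  refine hb.trans_lt ?_
  have : C * (max 1 (‖μ‖ ^ N) * (N.factorial * (ε / (D + 1)))) = ε * (D / (D + 1)) := by
    rw [hD]; ring
  rw [this]
  have : D / (D + 1) < 1 := by rw [div_lt_one (by positivity)]; linarith
  nlinarith

/-! ### Vanishing off the support, and cut-off functions -/

namespace SmoothSpace

/-- The pointwise product on `ℰ(ℝ)`. -/
def mul (g f : SmoothSpace) : SmoothSpace := mk (fun x => g x * f x) (g.contDiff.mul f.contDiff)

@[simp] theorem mul_apply (g f : SmoothSpace) (x : ℝ) : mul g f x = g x * f x := rfl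

theorem iteratedDeriv_eq_zero_of_eventuallyEq {f : SmoothSpace} {x : ℝ} (h : ∀ᶠ y in 𝓝 x, f y = 0)
    (n : ℕ) : iteratedDeriv n f x = 0 := by
  have : ⇑f =ᶠ[𝓝 x] fun _ => 0 := h
  rw [this.iteratedDeriv_eq, iteratedDeriv_const]
  simp

theorem norm_iteratedDeriv_mul_le {f g : SmoothSpace} {x A B d : ℝ} {N : ℕ} (hd : 1 ≤ d)
    (hf : ∀ n ≤ N, ‖iteratedDeriv n f x‖ ≤ A * d ^ n)
    (hg : ∀ n ≤ N, ‖iteratedDeriv n g x‖ ≤ B * d ^ n) {n : ℕ} (hn : n ≤ N) :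
    ‖iteratedDeriv n (mul f g) x‖ ≤ 2 ^ N * (A * B) * d ^ n := by
  have h0 := (norm_nonneg _).trans (hf 0 (Nat.zero_le _))
  have h0' := (norm_nonneg _).trans (hg 0 (Nat.zero_le _))
  simp only [pow_zero, mul_one] at h0 h0'
  have he : iteratedDeriv n (mul f g) x = ∑ i ∈ .range (n + 1),
      n.choose i * iteratedDeriv i f x * iteratedDeriv (n - i) g x :=
    iteratedDeriv_fun_mul (f.contDiff.of_le (mod_cast le_top)).contDiffAt
      (g.contDiff.of_le (mod_cast le_top)).contDiffAt
  rw [he]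
  calc _ ≤ ∑ i ∈ Finset.range (n + 1), (n.choose i : ℝ) * (A * B * d ^ n) := by
        refine norm_sum_le_of_le _ fun i hi => ?_
        have hi' : i ≤ n := Nat.lt_succ_iff.mp (Finset.mem_range.mp hi)
        rw [norm_mul, norm_mul, Complex.norm_natCast, mul_assoc]
        refine mul_le_mul_of_nonneg_left ?_ (Nat.cast_nonneg _)
        calc _ ≤ (A * d ^ i) * (B * d ^ (n - i)) :=
              mul_le_mul (hf i (hi'.trans hn)) (hg _ ((Nat.sub_le _ _).trans hn))
                (norm_nonneg _) (by positivity)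
          _ = A * B * (d ^ i * d ^ (n - i)) := by ring
          _ = _ := by rw [← pow_add, Nat.add_sub_cancel' hi']
    _ = 2 ^ n * (A * B) * d ^ n := by
        rw [← Finset.sum_mul, ← Nat.cast_sum, Nat.sum_range_choose]; push_cast; ring
    _ ≤ _ := by gcongr; norm_num

end SmoothSpace

/-- A compactly supported distribution annihilates every smooth function that vanishes near its
support. Compactness reduces this to finitely many of the open sets on which `T` vanishes by
definition of the support, and a partition of unity glues these together. -/
theorem apply_eq_zero_of_tsupport_subset (T : CompactDistribution) (f : SmoothSpace)
    (hf : tsupport f ⊆ (Distribution.dsupport T)ᶜ) : T f = 0 := by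
  obtain ⟨K, N, C, hC, hT⟩ := exists_bound T
  set S : Set ℝ := Set.Icc (-(K + 1 : ℝ)) (K + 1) ∩ tsupport f with hS
  have hSc : IsCompact S := isCompact_Icc.inter_right (isClosed_tsupport f)
  have hloc : ∀ x : S, ∃ s : Set ℝ, Distribution.IsVanishingOn T s ∧ IsOpen s ∧ (x : ℝ) ∈ s :=
    fun x => (Distribution.notMem_dsupport_iff _).mp (hf x.2.2)
  choose V hV hVo hVm using hloc
  obtain ⟨t, ht⟩ := hSc.elim_finite_subcover V hVo fun x hx => Set.mem_iUnion.mpr ⟨⟨x, hx⟩, hVm _⟩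
  obtain ⟨ρ, hρ⟩ := SmoothPartitionOfUnity.exists_isSubordinate (modelWithCornersSelf ℝ ℝ)
    hSc.isClosed (fun i : t => V i) (fun i => hVo i) (by simpa [Set.iUnion_subtype] using ht)
  let r : t → SmoothSpace := fun i => mk (fun x => (ρ i x : ℂ))
    (Complex.ofRealCLM.contDiff.comp (ρ i).contMDiff.contDiff)
  have h1 : ∀ i, T (mul (r i) f) = 0 := fun i => hV i _ (by
    refine (tsupport_mul_subset_left (f := r i) (g := f)).trans (Set.Subset.trans ?_ (hρ i))
    exact tsupport_comp_subset (g := ((↑) : ℝ → ℂ)) Complex.ofReal_zero _)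
  have h2 : T (f - ∑ i, mul (r i) f) = 0 := by
    refine norm_le_zero_iff.mp ((hT _ 0 le_rfl fun n _ x hx => ?_).trans_eq (mul_zero _))
    rw [iteratedDeriv_eq_zero_of_eventuallyEq, norm_zero]
    have hx' : x ∈ Set.Ioo (-(K + 1 : ℝ)) (K + 1) := by
      rw [abs_le] at hx
      constructor <;> linarith
    filter_upwards [isOpen_Ioo.mem_nhds hx'] with y hy
    by_cases hys : y ∈ tsupport f
    · have := ρ.sum_eq_one (x := y) ⟨Set.Ioo_subset_Icc_self hy, hys⟩
      rw [finsum_eq_sum_of_fintype] at this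
      have h3 : ∑ i, r i y = 1 := by
        have := congrArg ((↑) : ℝ → ℂ) this
        rwa [Complex.ofReal_sum, Complex.ofReal_one] at this
      simp only [sub_apply, sum_apply, mul_apply, ← Finset.sum_mul, h3, one_mul, sub_self]
    · simp [image_eq_zero_of_notMem_tsupport hys]
  simpa [map_sub, h1] using h2

theorem iteratedDeriv_comp_affine {g : ℝ → ℂ} (hg : ContDiff ℝ ∞ g) (c d : ℝ) (n : ℕ) :
    iteratedDeriv n (fun x : ℝ => g (c + d * x)) =
      fun x => d ^ n • iteratedDeriv n g (c + d * x) := by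
  have h : ContDiff ℝ ∞ fun x => g (c + x) := hg.comp (contDiff_const.add contDiff_id)
  rw [iteratedDeriv_comp_const_smul (f := fun x => g (c + x)) (h.of_le (mod_cast le_top)),
    iteratedDeriv_comp_const_add]

/-- The smooth transition from `0` (for `x ≤ 0`) to `1` (for `1 ≤ x`), as an element of `ℰ(ℝ)`. -/
def transition : SmoothSpace := mk (fun x => (Real.smoothTransition x : ℂ))
  (Complex.ofRealCLM.contDiff.comp Real.smoothTransition.contDiff)

theorem transition_apply (x : ℝ) : transition x = Real.smoothTransition x := rfl

theorem transition_of_nonpos {x : ℝ} (h : x ≤ 0) : transition x = 0 := by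
  simp [transition_apply, Real.smoothTransition.zero_of_nonpos h]

theorem transition_of_one_le {x : ℝ} (h : 1 ≤ x) : transition x = 1 := by
  simp [transition_apply, Real.smoothTransition.one_of_one_le h]

theorem exists_norm_iteratedDeriv_transition_le (N : ℕ) :
    ∃ A : ℝ, ∀ n ≤ N, ∀ x, ‖iteratedDeriv n transition x‖ ≤ A := by
  have h1 : ∀ n, ∃ A : ℝ, ∀ x, ‖iteratedDeriv n transition x‖ ≤ A := fun n => by
    obtain ⟨A, hA⟩ := (isCompact_Icc (a := (0 : ℝ)) (b := 1)).exists_bound_of_continuousOn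
      (transition.contDiff.continuous_iteratedDeriv n (mod_cast le_top)).continuousOn
    refine ⟨max A 1, fun x => ?_⟩
    have hc : ∀ c : ℂ, ‖c‖ ≤ 1 → (⇑transition =ᶠ[𝓝 x] fun _ => c) →
        ‖iteratedDeriv n transition x‖ ≤ max A 1 := fun c hc h => by
      rw [h.iteratedDeriv_eq, iteratedDeriv_const]
      refine le_max_of_le_right ?_
      split_ifs <;> simp [hc]
    rcases lt_or_ge x 0 with hx | hx
    · exact hc 0 (by simp) ((eventually_lt_nhds hx).mono fun y hy => transition_of_nonpos hy.le)
    rcases lt_or_ge 1 x with hx' | hx'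
    · exact hc 1 (by simp) ((eventually_gt_nhds hx').mono fun y hy => transition_of_one_le hy.le)
    · exact le_max_of_le_left (hA x ⟨hx, hx'⟩)
  choose A hA using h1
  refine ⟨∑ n ∈ Finset.range (N + 1), A n, fun n hn x => (hA n x).trans ?_⟩
  exact Finset.single_le_sum (f := A) (fun i _ => (norm_nonneg _).trans (hA i 0))
    (Finset.mem_range.mpr (Nat.lt_succ_of_le hn))

/-- The composition of the smooth transition with an affine map. -/
def affineTransition (c d : ℝ) : SmoothSpace := mk (fun x => transition (c + d * x))
  (transition.contDiff.comp (contDiff_const.add (contDiff_const.mul contDiff_id)))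

@[simp] theorem affineTransition_apply (c d x : ℝ) :
    affineTransition c d x = transition (c + d * x) := rfl

/-- A cut-off function: it is `1` for `|x| ≤ b + 1/d` and `0` for `|x| ≥ b + 2/d`. -/
def cutoff (b d : ℝ) : SmoothSpace :=
  mul (affineTransition (2 + d * b) d) (affineTransition (2 + d * b) (-d))

theorem cutoff_eq_one {b d x : ℝ} (h : d * (|x| - b) ≤ 1) (hd : 0 < d) : cutoff b d x = 1 := by
  have h1 := mul_le_mul_of_nonneg_left (le_abs_self x) hd.le
  have h2 := mul_le_mul_of_nonneg_left (neg_abs_le x) hd.le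
  simp only [cutoff, mul_apply, affineTransition_apply]
  rw [transition_of_one_le (by linarith), transition_of_one_le (by linarith), one_mul]

theorem cutoff_eq_zero {b d x : ℝ} (h : 2 ≤ d * (|x| - b)) : cutoff b d x = 0 := by
  simp only [cutoff, mul_apply, affineTransition_apply]
  rcases abs_cases x with ⟨hx, -⟩ | ⟨hx, -⟩
  · rw [transition_of_nonpos (x := 2 + d * b + -d * x) (by rw [hx] at h; linarith), mul_zero]
  · rw [transition_of_nonpos (x := 2 + d * b + d * x) (by rw [hx] at h; linarith), zero_mul]

theorem exists_norm_iteratedDeriv_cutoff_le (N : ℕ) : ∃ A : ℝ, 0 ≤ A ∧ ∀ b d : ℝ, 1 ≤ d →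
    ∀ n ≤ N, ∀ x, ‖iteratedDeriv n (cutoff b d) x‖ ≤ A * d ^ n := by
  obtain ⟨A, hA⟩ := exists_norm_iteratedDeriv_transition_le N
  have hA0 : 0 ≤ A := (norm_nonneg _).trans (hA 0 (Nat.zero_le _) 0)
  refine ⟨2 ^ N * (A * A), by positivity, fun b d hd n hn x => ?_⟩
  have h : ∀ c e : ℝ, |e| = d → ∀ n ≤ N,
      ‖iteratedDeriv n (affineTransition c e) x‖ ≤ A * d ^ n := fun c e he n hn => by
    have := congrFun (iteratedDeriv_comp_affine transition.contDiff c e n) x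
    rw [show iteratedDeriv n (affineTransition c e) x = _ from this, norm_smul, norm_pow,
      Real.norm_eq_abs, he, mul_comm]
    gcongr
    exact hA n hn _
  exact norm_iteratedDeriv_mul_le hd (h _ _ (abs_of_nonneg (by linarith)))
    (h _ _ (by rw [abs_neg]; exact abs_of_nonneg (by linarith))) hn

/-! ### Exponential type of the transform of a distribution -/

/-- If `T` is supported in `[-b, b]` and `φ` grows no faster than the exponential function, then
`z ↦ T(φ(-iz·))` has exponential type `b` with a polynomial factor. For each `z` the test function
is cut off at distance `1/(1+|z|)` from `[-b, b]`: this costs only powers of `1+|z|`, and on the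
support of the cut-off function `exp(|x||Im z|)` exceeds `exp(b|Im z|)` by a bounded factor. -/
theorem exists_norm_apply_dilation_le (T : CompactDistribution) {b : ℝ}
    (hT : Distribution.dsupport T ⊆ Set.Icc (-b) b) {φ : ℂ → ℂ} (hφ : Differentiable ℂ φ)
    (hφb : ∀ y, ‖φ y‖ ≤ Real.exp |y.re|) : ∃ N : ℕ, ∃ C : ℝ, 0 < C ∧
      ∀ z : ℂ, ‖T (dilation φ hφ (-Complex.I * z))‖ ≤
        C * (1 + ‖z‖) ^ N * Real.exp (b * |z.im|) := by
  obtain ⟨K, N, C, hC, hTb⟩ := exists_bound T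
  obtain ⟨A, hA0, hA⟩ := exists_norm_iteratedDeriv_cutoff_le N
  refine ⟨N, C * (2 ^ N * (A * (N.factorial * Real.exp 3))) + 1, by positivity, fun z => ?_⟩
  set d : ℝ := 1 + ‖z‖ with hd
  have hd1 : 1 ≤ d := by rw [hd]; linarith [norm_nonneg z]
  have hd0 : 0 < d := by linarith
  set S := dilation φ hφ (-Complex.I * z) with hS
  set E := Real.exp (b * |z.im|) with hE
  have him : |z.im| ≤ d := (Complex.abs_im_le_norm z).trans (by rw [hd]; linarith)
  -- The cut-off function does not change the value of `T`.
  have h1 : T S = T (mul (cutoff b d) S) := by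
    rw [← sub_eq_zero, ← map_sub]
    refine apply_eq_zero_of_tsupport_subset T _
      (Set.Subset.trans ?_ (Set.compl_subset_compl.mpr hT))
    refine fun x hx hxb => notMem_tsupport_iff_eventuallyEq.mpr ?_ hx
    have hx0 : d * (|x| - b) < 1 :=
      (mul_nonpos_of_nonneg_of_nonpos hd0.le (sub_nonpos.mpr (abs_le.mpr hxb))).trans_lt one_pos
    have hc : Continuous fun y : ℝ => d * (|y| - b) := by fun_prop
    filter_upwards [hc.continuousAt.eventually (eventually_lt_nhds hx0)] with y hy
    simp [cutoff_eq_one hy.le hd0]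
  have h2 : ‖T (mul (cutoff b d) S)‖ ≤
      C * (2 ^ N * (A * (N.factorial * Real.exp 3 * E)) * d ^ N) := by
    refine hTb _ _ (by positivity) fun n hn x _ => ?_
    rcases lt_or_ge 2 (d * (|x| - b)) with hx | hx
    · rw [iteratedDeriv_eq_zero_of_eventuallyEq, norm_zero]
      · positivity
      · have hc : Continuous fun y : ℝ => d * (|y| - b) := by fun_prop
        filter_upwards [hc.continuousAt.eventually (eventually_gt_nhds hx)] with y hy
        simp [cutoff_eq_zero hy.le]
    · refine (norm_iteratedDeriv_mul_le hd1 (fun m hm => hA b d hd1 m hm x)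
        (fun m hm => ?_) hn).trans
        (mul_le_mul_of_nonneg_left (pow_le_pow_right₀ hd1 hn) (by positivity))
      rw [hS, show ⇑(dilation φ hφ (-Complex.I * z)) = fun x : ℝ => φ (-Complex.I * z * x) from rfl,
        iteratedDeriv_comp_mul_ofReal hφ, norm_mul, norm_pow, norm_mul, norm_neg, Complex.norm_I,
        one_mul, mul_comm]
      have h3 : ‖iteratedDeriv m φ (-Complex.I * z * x)‖ ≤ m.factorial * (Real.exp 3 * E) := by
        refine norm_iteratedDeriv_le_of_unit_sphere hφ m _ fun w hw => (hφb w).trans ?_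
        rw [hE, ← Real.exp_add]
        refine Real.exp_le_exp.mpr ?_
        have h4 : |(w - -Complex.I * z * x).re| ≤ 1 := by
          refine (Complex.abs_re_le_norm _).trans_eq ?_
          simpa [dist_eq_norm] using hw
        have h5 : (-Complex.I * z * x).re = z.im * x := by simp
        rw [Complex.sub_re, h5] at h4
        have h6 : |w.re| ≤ 1 + |z.im| * |x| := by
          rw [← abs_mul]
          calc |w.re| = |(w.re - z.im * x) + z.im * x| := by ring_nf
            _ ≤ _ := (abs_add_le _ _).trans (by gcongr)
        have h7 : |z.im| * (|x| - b) ≤ 2 := by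
          rcases le_total 0 (|x| - b) with h | h
          · exact (mul_le_mul_of_nonneg_right him h).trans hx
          · nlinarith [abs_nonneg z.im]
        linarith
      have h8 : (m.factorial : ℝ) ≤ N.factorial := by exact_mod_cast Nat.factorial_le hm
      calc _ ≤ (m.factorial * (Real.exp 3 * E)) * ‖z‖ ^ m := by gcongr
        _ ≤ (N.factorial * (Real.exp 3 * E)) * d ^ m := by
          gcongr
          rw [hd]; linarith
        _ = _ := by ring
  rw [h1]
  refine h2.trans ?_
  have : 0 ≤ d ^ N * E := by positivity
  linarith

/-! ### The kernel as an average of exponentials -/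

/-- The moment series of the Laplace transform of a measure on `[-1, 1]`. -/
theorem hasSum_integral_cexp (ρ : Measure ℝ) [IsFiniteMeasure ρ] (hρ : ∀ᵐ w ∂ρ, |w| ≤ 1) (y : ℂ) :
    HasSum (fun n : ℕ => (∫ w, (w : ℂ) ^ n ∂ρ) / n.factorial * y ^ n)
      (∫ w, Complex.exp (y * w) ∂ρ) := by
  have hb : ∀ n : ℕ, ∀ᵐ w : ℝ ∂ρ, ‖(y * (w : ℂ)) ^ n / n.factorial‖ ≤
      ‖y‖ ^ n / n.factorial := fun n => by
    filter_upwards [hρ] with w hw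
    rw [norm_div, norm_pow, norm_mul, Complex.norm_natCast, Complex.norm_real, Real.norm_eq_abs]
    gcongr
    exact mul_le_of_le_one_right (norm_nonneg _) hw
  have hi : ∀ n : ℕ, Integrable (fun w : ℝ => (y * (w : ℂ)) ^ n / n.factorial) ρ := fun n =>
    (integrable_const _).mono' (by fun_prop) (hb n)
  have hs : Summable fun n : ℕ => ∫ w : ℝ, ‖(y * (w : ℂ)) ^ n / n.factorial‖ ∂ρ := by
    refine Summable.of_nonneg_of_le (fun n => integral_nonneg fun _ => norm_nonneg _) (fun n => ?_)
      ((Real.summable_pow_div_factorial ‖y‖).mul_right (ρ.real Set.univ))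
    refine (integral_mono_ae (hi n).norm (integrable_const _) (hb n)).trans_eq ?_
    simp [mul_comm]
  have := hasSum_integral_of_summable_integral_norm hi hs
  have h1 : ∀ n : ℕ, ∫ w : ℝ, (y * (w : ℂ)) ^ n / n.factorial ∂ρ
      = (∫ w : ℝ, (w : ℂ) ^ n ∂ρ) / n.factorial * y ^ n := fun n => by
    rw [← integral_div, ← integral_mul_const]
    exact integral_congr_ae (ae_of_all _ fun w => by ring)
  have h2 : ∀ w : ℝ, ∑' n : ℕ, (y * (w : ℂ)) ^ n / n.factorial = Complex.exp (y * w) := fun w => by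
    rw [Complex.exp_eq_exp_ℂ, NormedSpace.exp_eq_tsum_div]
  simpa only [h1, h2] using this

theorem norm_integral_cexp_le (ρ : Measure ℝ) [IsProbabilityMeasure ρ] (hρ : ∀ᵐ w ∂ρ, |w| ≤ 1)
    (y : ℂ) : ‖∫ w, Complex.exp (y * w) ∂ρ‖ ≤ Real.exp |y.re| := by
  refine (norm_integral_le_of_norm_le (integrable_const (Real.exp |y.re|)) ?_).trans_eq (by simp)
  filter_upwards [hρ] with w hw
  rw [Complex.norm_exp, Real.exp_le_exp, Complex.re_mul_ofReal]
  refine (le_abs_self _).trans ?_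
  rw [abs_mul]
  exact mul_le_of_le_one_right (abs_nonneg _) hw

open ProbabilityTheory in
/-- The law of the square root of a random variable with the beta distribution. -/
def sqrtBeta (p q : ℝ) : Measure ℝ := (betaMeasure p q).map Real.sqrt

theorem isProbabilityMeasure_sqrtBeta {p q : ℝ} (hp : 0 < p) (hq : 0 < q) :
    IsProbabilityMeasure (sqrtBeta p q) :=
  have := ProbabilityTheory.isProbabilityMeasureBeta hp hq
  Measure.isProbabilityMeasure_map (by fun_prop)

theorem ae_sqrtBeta_abs_le_one (p q : ℝ) : ∀ᵐ w ∂sqrtBeta p q, |w| ≤ 1 := by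
  rw [sqrtBeta, ae_map_iff (by fun_prop) (measurableSet_le (by fun_prop) (by fun_prop)),
    ProbabilityTheory.betaMeasure, ae_withDensity_iff (by
      unfold ProbabilityTheory.betaPDF; fun_prop)]
  refine ae_of_all _ fun x hx => ?_
  have h1 : x ≤ 1 := by
    by_contra! h
    exact hx (ProbabilityTheory.betaPDF_eq_zero_of_one_le h.le)
  rw [abs_of_nonneg (Real.sqrt_nonneg x)]
  exact Real.sqrt_le_one.mpr h1

theorem integral_betaPDFReal {p q : ℝ} (hp : 0 < p) (hq : 0 < q) :
    ∫ x, ProbabilityTheory.betaPDFReal p q x = 1 := by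
  have h0 : 0 ≤ᵐ[volume] ProbabilityTheory.betaPDFReal p q := ae_of_all _ fun x => by
    by_cases hx : 0 < x ∧ x < 1
    · exact (ProbabilityTheory.betaPDFReal_pos hx.1 hx.2 hp hq).le
    · simp [ProbabilityTheory.betaPDFReal, hx]
  rw [integral_eq_lintegral_of_nonneg_ae h0 (by fun_prop)]
  exact (congrArg ENNReal.toReal (ProbabilityTheory.lintegral_betaPDF_eq_one hp hq)).trans (by simp)

open ProbabilityTheory in
theorem integral_pow_sqrtBeta {p q : ℝ} (hp : 0 < p) (hq : 0 < q) (n : ℕ) :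
    ∫ w, (w : ℂ) ^ n ∂sqrtBeta p q = ((beta (p + n / 2) q / beta p q : ℝ) : ℂ) := by
  have hpn : 0 < p + n / 2 := by positivity
  have hm : Measurable (betaPDF p q) := by unfold betaPDF; fun_prop
  have hreal : ∫ w, w ^ n ∂sqrtBeta p q = beta (p + n / 2) q / beta p q := by
    rw [sqrtBeta, integral_map (by fun_prop) (by fun_prop), betaMeasure,
      integral_withDensity_eq_integral_toReal_smul hm
        (ae_of_all _ fun _ => by rw [betaPDF]; exact ENNReal.ofReal_lt_top)]
    have : ∀ x, (betaPDF p q x).toReal • √x ^ n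
        = beta (p + n / 2) q / beta p q * betaPDFReal (p + n / 2) q x := fun x => by
      have hB := (beta_pos hp hq).ne'
      have hB' := (beta_pos hpn hq).ne'
      by_cases hx : 0 < x ∧ x < 1
      · rw [betaPDF, ENNReal.toReal_ofReal (betaPDFReal_pos hx.1 hx.2 hp hq).le, betaPDFReal,
          betaPDFReal, if_pos hx, if_pos hx, smul_eq_mul, Real.sqrt_eq_rpow, ← Real.rpow_natCast,
          ← Real.rpow_mul hx.1.le, show p + n / 2 - 1 = (p - 1) + 1 / 2 * n by ring,
          Real.rpow_add hx.1]
        generalize beta (p + n / 2) q = B at hB'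
        field_simp
      · simp [betaPDF, betaPDFReal, hx]
    simp_rw [this]
    rw [integral_const_mul, integral_betaPDFReal hpn hq, mul_one]
  rw [← hreal, ← integral_complex_ofReal]
  simp

/-- The entire function `φ` with `S^α_μ(x) = φ(μ x)`. -/
def kernelProfile (α : ℝ) (y : ℂ) : ℂ :=
  normalizedBessel α (Complex.I * y) - Complex.I * normalizedStruve α (Complex.I * y)

theorem differentiable_kernelProfile (α : ℝ) : Differentiable ℂ (kernelProfile α) :=
  ((differentiable_normalizedBessel α).comp (by fun_prop)).sub
    (((differentiable_normalizedStruve α).comp (by fun_prop)).const_mul _)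

theorem smoothKernel_eq_dilation (α : ℝ) (μ : ℂ) :
    smoothKernel α μ = dilation (kernelProfile α) (differentiable_kernelProfile α) μ := by
  ext x
  simp [smoothKernel, kernel, kernelProfile, mk_apply, mul_assoc]

/-- The `n`-th moment of the square root of a `Beta(1/2, α + 1/2)` variable, divided by `n!`; the
duplication formula for the Gamma function brings it to the form of the coefficients of the Bessel
and Struve series. -/
theorem beta_ratio_div_factorial {α : ℝ} (hα : -1 / 2 < α) (n : ℕ) :
    ProbabilityTheory.beta (1 / 2 + n / 2) (α + 1 / 2) / ProbabilityTheory.beta (1 / 2) (α + 1 / 2)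
        / n.factorial =
      Real.Gamma (α + 1) / (2 ^ n * (Real.Gamma (n / 2 + 1) * Real.Gamma (n / 2 + α + 1))) := by
  have hd := Real.Gamma_mul_Gamma_add_half (1 / 2 + n / 2)
  rw [show (2 : ℝ) * (1 / 2 + n / 2) = n + 1 by ring, Real.Gamma_nat_eq_factorial,
    show (1 : ℝ) - (n + 1) = -n by ring, Real.rpow_neg zero_le_two, Real.rpow_natCast,
    show (1 : ℝ) / 2 + n / 2 + 1 / 2 = n / 2 + 1 by ring] at hd
  have h1 : 0 < Real.Gamma (1 / 2 + n / 2) := Real.Gamma_pos_of_pos (by positivity)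
  have h2 : 0 < Real.Gamma ((n : ℝ) / 2 + 1) := Real.Gamma_pos_of_pos (by positivity)
  have h3 : 0 < Real.Gamma (α + 1 / 2) := Real.Gamma_pos_of_pos (by linarith)
  have h4 : 0 < Real.Gamma (α + 1) := Real.Gamma_pos_of_pos (by linarith)
  have h5 : 0 < Real.Gamma ((n : ℝ) / 2 + α + 1) :=
    Real.Gamma_pos_of_pos (by have : (0 : ℝ) ≤ n / 2 := by positivity
                              linarith)
  have h6 : 0 < √Real.pi := Real.sqrt_pos.mpr Real.pi_pos
  have h7 : (0 : ℝ) < n.factorial := by exact_mod_cast n.factorial_pos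
  simp only [ProbabilityTheory.beta]
  rw [show (1 : ℝ) / 2 + (α + 1 / 2) = α + 1 by ring,
    show (1 : ℝ) / 2 + n / 2 + (α + 1 / 2) = n / 2 + α + 1 by ring, Real.Gamma_one_half_eq]
  generalize Real.Gamma (1 / 2 + n / 2) = g₁ at *
  generalize Real.Gamma ((n : ℝ) / 2 + 1) = g₂ at *
  generalize Real.Gamma (α + 1 / 2) = g₃ at *
  generalize Real.Gamma ((n : ℝ) / 2 + α + 1) = g₅ at *
  field_simp
  field_simp at hd
  linear_combination hd

theorem bessel_term (G F H y : ℂ) (k : ℕ) : G / (2 ^ (2 * k) * (F * H)) * y ^ (2 * k)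
    = G * ((-1) ^ k * (Complex.I * y / 2) ^ (2 * k) / (F * H)) := by
  have h2 : (Complex.I * y / 2) ^ (2 * k) = (-1) ^ k * (y / 2) ^ (2 * k) := by
    rw [mul_div_assoc, mul_pow, pow_mul Complex.I, Complex.I_sq]
  have h3 : ((-1 : ℂ) ^ k) * (-1) ^ k = 1 := by rw [← mul_pow]; simp
  rw [h2, ← mul_assoc ((-1 : ℂ) ^ k), h3, one_mul, div_pow]
  ring

theorem struve_term (G F H y : ℂ) (k : ℕ) : G / (2 ^ (2 * k + 1) * (F * H)) * y ^ (2 * k + 1)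
    = -(Complex.I * (G * ((-1) ^ k * (Complex.I * y / 2) ^ (2 * k + 1) / (F * H)))) := by
  have h2 : (Complex.I * y / 2) ^ (2 * k + 1)
      = Complex.I * ((-1) ^ k * (y / 2) ^ (2 * k + 1)) := by
    rw [mul_div_assoc, mul_pow, pow_succ, pow_mul Complex.I, Complex.I_sq]; ring
  have h3 : ((-1 : ℂ) ^ k) * (-1) ^ k = 1 := by rw [← mul_pow]; simp
  have h4 : -(Complex.I * (G * ((-1) ^ k * (Complex.I * ((-1) ^ k * (y / 2) ^ (2 * k + 1))) /
      (F * H)))) = -(Complex.I * Complex.I) * (((-1 : ℂ) ^ k) * (-1) ^ k) *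
        (G * (y / 2) ^ (2 * k + 1) / (F * H)) := by ring
  rw [h2, h4, h3, Complex.I_mul_I, div_pow]
  ring

/-- The Bessel–Struve kernel is an average of exponentials. -/
theorem kernelProfile_eq_integral {α : ℝ} (hα : -1 / 2 < α) (y : ℂ) :
    kernelProfile α y = ∫ w, Complex.exp (y * w) ∂sqrtBeta (1 / 2) (α + 1 / 2) := by
  have hq : 0 < α + 1 / 2 := by linarith
  have := isProbabilityMeasure_sqrtBeta one_half_pos hq
  have hs := hasSum_integral_cexp (sqrtBeta (1 / 2) (α + 1 / 2)) (ae_sqrtBeta_abs_le_one _ _) y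
  have hc : ∀ n : ℕ, (∫ w, (w : ℂ) ^ n ∂sqrtBeta (1 / 2) (α + 1 / 2)) / n.factorial
      = ((Real.Gamma (α + 1) / (2 ^ n * (Real.Gamma (n / 2 + 1) * Real.Gamma (n / 2 + α + 1))) : ℝ)
        : ℂ) := fun n => by
    rw [← beta_ratio_div_factorial hα, integral_pow_sqrtBeta one_half_pos hq,
      Complex.ofReal_div (_ / _), Complex.ofReal_natCast]
  simp only [hc] at hs
  set a : ℕ → ℂ := fun n => ((Real.Gamma (α + 1) /
    (2 ^ n * (Real.Gamma (n / 2 + 1) * Real.Gamma (n / 2 + α + 1))) : ℝ) : ℂ) * y ^ n with ha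
  have he : Summable fun k => a (2 * k) := hs.summable.comp_injective fun k l h => by simpa using h
  have ho : Summable fun k => a (2 * k + 1) :=
    hs.summable.comp_injective fun k l h => by simpa using h
  rw [← hs.tsum_eq, ← tsum_even_add_odd (f := a) he ho, kernelProfile, normalizedBessel,
    normalizedStruve,
    sub_eq_add_neg, ← tsum_mul_left, ← tsum_mul_left, ← tsum_mul_left, ← tsum_neg]
  congr 1
  · refine tsum_congr fun k => ?_
    have h1 : ((2 * k : ℕ) : ℝ) / 2 = k := by push_cast; ring
    simp only [ha]
    rw [← bessel_term, h1, Real.Gamma_nat_eq_factorial]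
    simp only [Complex.ofReal_div, Complex.ofReal_mul, Complex.ofReal_pow, Complex.ofReal_ofNat,
      Complex.ofReal_natCast]
  · refine tsum_congr fun k => ?_
    have h1 : ((2 * k + 1 : ℕ) : ℝ) / 2 + 1 = k + 3 / 2 := by push_cast; ring
    have h2 : ((2 * k + 1 : ℕ) : ℝ) / 2 + α + 1 = k + α + 3 / 2 := by push_cast; ring
    simp only [ha]
    rw [← struve_term, h1, h2]
    simp only [Complex.ofReal_div, Complex.ofReal_mul, Complex.ofReal_pow, Complex.ofReal_ofNat]

theorem norm_kernelProfile_le {α : ℝ} (hα : -1 / 2 < α) (y : ℂ) :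
    ‖kernelProfile α y‖ ≤ Real.exp |y.re| := by
  have := isProbabilityMeasure_sqrtBeta one_half_pos (show 0 < α + 1 / 2 by linarith)
  rw [kernelProfile_eq_integral hα]
  exact norm_integral_cexp_le _ (ae_sqrtBeta_abs_le_one _ _) y

theorem hasSum_kernelProfile {α : ℝ} (hα : -1 / 2 < α) (y : ℂ) :
    HasSum (fun n : ℕ => ((ProbabilityTheory.beta (1 / 2 + n / 2) (α + 1 / 2) /
        ProbabilityTheory.beta (1 / 2) (α + 1 / 2) : ℝ) : ℂ) / n.factorial * y ^ n)
      (kernelProfile α y) := by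
  have hq : 0 < α + 1 / 2 := by linarith
  have := isProbabilityMeasure_sqrtBeta one_half_pos hq
  rw [kernelProfile_eq_integral hα]
  simpa only [integral_pow_sqrtBeta one_half_pos hq] using
    hasSum_integral_cexp (sqrtBeta (1 / 2) (α + 1 / 2)) (ae_sqrtBeta_abs_le_one _ _) y

/-! ### The Paley–Wiener theorem for rapidly decaying functions -/

/-- `H` is entire, and `|H(z)| ≤ C (1+|z|)ᵐ exp(b|Im z|)` for some `C`; negative `m` are allowed. -/
def PaleyWienerBound (b : ℝ) (m : ℤ) (H : ℂ → ℂ) : Prop :=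
  Differentiable ℂ H ∧ ∃ C : ℝ, 0 ≤ C ∧ ∀ z, ‖H z‖ ≤ C * (1 + ‖z‖) ^ m * Real.exp (b * |z.im|)

/-- The integral of an entire function over a horizontal line does not change under a vertical
shift, if the function decays quadratically in the strip between the lines. -/
theorem integral_eq_integral_add_mul_I {Φ : ℂ → ℂ} (hΦ : Differentiable ℂ Φ) {D Y : ℝ}
    (hD : ∀ ζ : ℂ, |ζ.im| ≤ |Y| → ‖Φ ζ‖ ≤ D * (1 + ζ.re ^ 2)⁻¹) :
    ∫ x : ℝ, Φ x = ∫ x : ℝ, Φ (x + Y * Complex.I) := by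
  have hi : ∀ y : ℝ, |y| ≤ |Y| → Integrable fun x : ℝ => Φ (x + y * Complex.I) := fun y hy =>
    (integrable_inv_one_add_sq.const_mul D).mono'
      (hΦ.continuous.comp (by fun_prop)).aestronglyMeasurable
      (ae_of_all _ fun x => by simpa using hD (x + y * Complex.I) (by simpa using hy))
  have h0 : Integrable fun x : ℝ => Φ x := by simpa using hi 0 (by simp)
  have hY := hi Y le_rfl
  have t0 := intervalIntegral_tendsto_integral h0 tendsto_neg_atTop_atBot tendsto_id
  have tY := intervalIntegral_tendsto_integral hY tendsto_neg_atTop_atBot tendsto_id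
  -- The integrals over the vertical sides of the rectangle tend to zero.
  have hv : ∀ s : ℝ, |s| = 1 → Tendsto (fun R : ℝ => ∫ y in (0 : ℝ)..Y,
      Φ ((s * R : ℝ) + y * Complex.I)) atTop (𝓝 0) := fun s hs => by
    have hlim : Tendsto (fun R : ℝ => D * (1 + R ^ 2)⁻¹ * |Y - 0|) atTop (𝓝 0) := by
      have : Tendsto (fun R : ℝ => (1 + R ^ 2)⁻¹) atTop (𝓝 0) :=
        tendsto_inv_atTop_zero.comp (tendsto_atTop_add_const_left _ _
          (tendsto_pow_atTop two_ne_zero))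
      simpa using (this.const_mul D).mul_const |Y - 0|
    refine squeeze_zero_norm (fun R => ?_) hlim
    refine intervalIntegral.norm_integral_le_of_norm_le_const fun y hy => ?_
    have hy' : |y| ≤ |Y| := by
      rcases Set.mem_uIoc.mp hy with h | h
      · rw [abs_of_pos h.1, abs_of_pos (h.1.trans_le h.2)]; exact h.2
      · rw [abs_of_nonpos h.2, abs_of_neg (h.1.trans_le h.2)]; linarith [h.1]
    have hR : (s * R) ^ 2 = R ^ 2 := by rw [mul_pow, ← sq_abs s, hs]; ring
    have := hD ((s * R : ℝ) + y * Complex.I) (by simpa using hy')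
    have hre : (((s * R : ℝ) : ℂ) + y * Complex.I).re = s * R := by simp
    rwa [hre, hR] at this
  have hrect : ∀ R : ℝ, (∫ x in (-R)..(id R), Φ x) - (∫ x in (-R)..(id R), Φ (x + Y * Complex.I))
      + Complex.I * (∫ y in (0 : ℝ)..Y, Φ ((1 * R : ℝ) + y * Complex.I))
      - Complex.I * (∫ y in (0 : ℝ)..Y, Φ ((-1 * R : ℝ) + y * Complex.I)) = 0 := fun R => by
    have := Complex.integral_boundary_rect_eq_zero_of_differentiableOn Φ (-R : ℝ)
      (R + Y * Complex.I) hΦ.differentiableOn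
    simpa using this
  have hlim := ((t0.sub tY).add ((hv 1 (by simp)).const_mul Complex.I)).sub
    ((hv (-1) (by simp)).const_mul Complex.I)
  simp only [mul_zero, add_zero, sub_zero] at hlim
  exact sub_eq_zero.mp (tendsto_nhds_unique hlim (tendsto_const_nhds.congr fun R => (hrect R).symm))

open FourierTransform in
/-- An entire function of exponential type `b` that decays like `|z|⁻²` on horizontal lines is the
Fourier transform of a continuous density supported in `[-b, b]`; its Taylor coefficients are
therefore the moments of that density. -/
theorem exists_density {b : ℝ} {H : ℂ → ℂ} (hH : PaleyWienerBound b (-2) H) :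
    ∃ g : ℝ → ℂ, Continuous g ∧ (∀ x, b < |x| → g x = 0) ∧
      ∀ n : ℕ, ∫ x, g x * (x : ℂ) ^ n = Complex.I ^ n * iteratedDeriv n H 0 := by
  obtain ⟨hd, C, hC, hb⟩ := hH
  set h : ℝ → ℂ := fun ξ => H ((2 * Real.pi : ℝ) * ξ) with hh
  have hpi := Real.pi_pos
  have hdecay : ∀ ζ : ℂ, ‖H ((2 * Real.pi : ℝ) * ζ)‖ ≤
      C * (1 + ζ.re ^ 2)⁻¹ * Real.exp (b * (2 * Real.pi * |ζ.im|)) := fun ζ => by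
    refine (hb _).trans ?_
    have h1 : ((2 * Real.pi : ℝ) * ζ).im = 2 * Real.pi * ζ.im := Complex.im_ofReal_mul _ _
    rw [h1, abs_mul, abs_of_pos (by positivity : 0 < 2 * Real.pi)]
    refine mul_le_mul_of_nonneg_right (mul_le_mul_of_nonneg_left ?_ hC) (Real.exp_pos _).le
    rw [zpow_neg]
    refine inv_anti₀ (by positivity) ?_
    have h2 : |ζ.re| ≤ ‖(2 * Real.pi : ℝ) * ζ‖ := by
      rw [norm_mul, Complex.norm_real, Real.norm_of_nonneg (by positivity)]
      have := Complex.abs_re_le_norm ζ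
      nlinarith [Real.pi_gt_three, norm_nonneg ζ]
    have h3 := sq_le_sq' (by linarith [abs_nonneg ζ.re]) h2
    rw [sq_abs] at h3
    rw [zpow_ofNat]
    have h4 := norm_nonneg (((2 * Real.pi : ℝ) : ℂ) * ζ)
    generalize ‖((2 * Real.pi : ℝ) : ℂ) * ζ‖ = r at *
    nlinarith
  have hcont : Continuous h := hd.continuous.comp (by fun_prop)
  have hint : Integrable h := (integrable_inv_one_add_sq.const_mul C).mono'
    hcont.aestronglyMeasurable (ae_of_all _ fun x => by simpa [hh] using hdecay x)
  set g : ℝ → ℂ := 𝓕⁻ h with hg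
  have hgF : ∀ x, g x = 𝓕 h (-x) := fun x => Real.fourierInv_eq_fourier_neg h x
  have hgcont : Continuous g := by
    have : Continuous (𝓕 h) := VectorFourier.fourierIntegral_continuous
      Real.continuous_fourierChar (by fun_prop) hint
    exact (this.comp continuous_neg).congr fun x => (hgF x).symm
  have hgz : ∀ x, b < |x| → g x = 0 := fun x hx => by
    set Φ : ℂ → ℂ := fun ζ => Complex.exp (2 * Real.pi * Complex.I * x * ζ) *
      H ((2 * Real.pi : ℝ) * ζ) with hΦ
    have hΦd : Differentiable ℂ Φ := by
      refine Differentiable.mul (by fun_prop) (hd.comp (by fun_prop))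
    have hgx : g x = ∫ ξ : ℝ, Φ ξ := by
      rw [hg, Real.fourierInv_eq']
      refine integral_congr_ae (ae_of_all _ fun ξ => ?_)
      simp only [hΦ, hh, smul_eq_mul, RCLike.inner_apply, conj_trivial]
      push_cast
      ring_nf
    have hΦn : ∀ ζ : ℂ, ‖Φ ζ‖ ≤ C * Real.exp (2 * Real.pi * (b * |ζ.im| - x * ζ.im)) *
        (1 + ζ.re ^ 2)⁻¹ := fun ζ => by
      have hre : (2 * Real.pi * Complex.I * x * ζ).re = - (2 * Real.pi * x * ζ.im) := by
        simp
      rw [hΦ, norm_mul, Complex.norm_exp, hre]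
      calc _ ≤ Real.exp (-(2 * Real.pi * x * ζ.im)) *
            (C * (1 + ζ.re ^ 2)⁻¹ * Real.exp (b * (2 * Real.pi * |ζ.im|))) := by
              gcongr; exact hdecay ζ
        _ = C * (Real.exp (-(2 * Real.pi * x * ζ.im)) * Real.exp (b * (2 * Real.pi * |ζ.im|))) *
              (1 + ζ.re ^ 2)⁻¹ := by ring
        _ = _ := by rw [← Real.exp_add]; ring_nf
    -- The line of integration is moved to height `t`, upwards or downwards according to the sign
    -- of `x`, and `t` tends to infinity.
    obtain ⟨s, hs, hsx⟩ : ∃ s : ℝ, |s| = 1 ∧ x * s = |x| := by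
      rcases abs_cases x with ⟨h, -⟩ | ⟨h, -⟩
      · exact ⟨1, by simp, by rw [h, mul_one]⟩
      · exact ⟨-1, by simp, by rw [h]; ring⟩
    have hle : ∀ t : ℝ, 0 ≤ t → ‖g x‖ ≤
        C * Real.exp (2 * Real.pi * (b - |x|) * t) * ∫ ξ : ℝ, (1 + ξ ^ 2)⁻¹ := fun t ht => by
      have hst : |s * t| = t := by rw [abs_mul, hs, one_mul, abs_of_nonneg ht]
      rw [hgx, integral_eq_integral_add_mul_I hΦd
        (D := C * Real.exp (2 * Real.pi * ((|b| + |x|) * t))) (Y := s * t) (fun ζ hζ => ?_),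
        ← integral_const_mul]
      · refine norm_integral_le_of_norm_le (integrable_inv_one_add_sq.const_mul _)
          (ae_of_all _ fun ξ => (hΦn _).trans_eq ?_)
        have him : ((ξ : ℂ) + (s * t : ℝ) * Complex.I).im = s * t := by simp
        have hre : ((ξ : ℂ) + (s * t : ℝ) * Complex.I).re = ξ := by simp
        rw [him, hre, hst, ← mul_assoc, hsx]
        ring_nf
      · refine (hΦn ζ).trans ?_
        rw [hst] at hζ
        have h1 : b * |ζ.im| - x * ζ.im ≤ (|b| + |x|) * t := by
          calc b * |ζ.im| - x * ζ.im ≤ |b| * |ζ.im| + |x| * |ζ.im| := by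
                have h2 := neg_abs_le (x * ζ.im)
                rw [abs_mul] at h2
                have h3 := mul_le_mul_of_nonneg_right (le_abs_self b) (abs_nonneg ζ.im)
                linarith
            _ = (|b| + |x|) * |ζ.im| := by ring
            _ ≤ _ := by gcongr
        gcongr
    have hlim : Tendsto (fun t : ℝ => C * Real.exp (2 * Real.pi * (b - |x|) * t) *
        ∫ ξ : ℝ, (1 + ξ ^ 2)⁻¹) atTop (𝓝 0) := by
      have hneg : 2 * Real.pi * (b - |x|) < 0 := mul_neg_of_pos_of_neg (by positivity) (by linarith)
      have := Real.tendsto_exp_atBot.comp (tendsto_id.const_mul_atTop_of_neg hneg)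
      simpa only [Function.comp_def, id, mul_zero, zero_mul] using
        (this.const_mul C).mul_const (∫ ξ : ℝ, (1 + ξ ^ 2)⁻¹)
    have := ge_of_tendsto hlim ((eventually_ge_atTop 0).mono hle)
    exact norm_le_zero_iff.mp this
  have hgs : HasCompactSupport g :=
    HasCompactSupport.intro (isCompact_Icc (a := -b) (b := b)) fun x hx => hgz x (by
      by_contra! hx'
      exact hx (abs_le.mp hx'))
  have hgi : ∀ n : ℕ, Integrable fun x : ℝ => x ^ n • g x := fun n =>
    ((continuous_id.pow n).smul hgcont).integrable_of_hasCompactSupport hgs.smul_left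
  have hF : 𝓕 g = h := by
    refine hcont.fourier_fourierInv_eq hint ?_
    have hg0 : Integrable g := by simpa using hgi 0
    exact hg0.comp_neg.congr (ae_of_all _ fun x => by simp [hgF])
  refine ⟨g, hgcont, hgz, fun n => ?_⟩
  have h1 := congrFun (Real.iteratedDeriv_fourier (N := ⊤) (n := n) (fun n _ => hgi n) le_top) 0
  rw [hF, hh, iteratedDeriv_comp_mul_ofReal hd, Real.fourier_real_eq] at h1
  have h2 : ∀ x : ℝ, (-2 * Real.pi * Complex.I * x) ^ n • g x
      = ((2 * Real.pi : ℝ) : ℂ) ^ n * ((-Complex.I) ^ n * (g x * (x : ℂ) ^ n)) := fun x => by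
    rw [smul_eq_mul, show (-2 * Real.pi * Complex.I * x : ℂ)
      = ((2 * Real.pi : ℝ) : ℂ) * ((-Complex.I) * x) by push_cast; ring, mul_pow, mul_pow]
    ring
  simp only [h2, mul_zero, neg_zero, Complex.ofReal_zero, AddChar.map_zero_eq_one, one_smul] at h1
  rw [integral_const_mul, integral_const_mul] at h1
  have h3 : ((2 * Real.pi : ℝ) : ℂ) ^ n ≠ 0 := pow_ne_zero _ (by
    rw [Complex.ofReal_ne_zero]; positivity)
  rw [mul_left_cancel₀ h3 h1, ← mul_assoc, ← mul_pow]
  simp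

/-! ### Operations on functions of Paley–Wiener type -/

namespace PaleyWienerBound

variable {b b' : ℝ} {m m' : ℤ} {H G : ℂ → ℂ}

theorem mono (hH : PaleyWienerBound b m H) (h : m ≤ m') : PaleyWienerBound b m' H := by
  obtain ⟨hd, C, hC, hb⟩ := hH
  refine ⟨hd, C, hC, fun z => (hb z).trans ?_⟩
  gcongr
  linarith [norm_nonneg z]

theorem add (hH : PaleyWienerBound b m H) (hG : PaleyWienerBound b m G) :
    PaleyWienerBound b m (fun z => H z + G z) := by
  obtain ⟨hd, C, hC, hb⟩ := hH
  obtain ⟨hd', C', hC', hb'⟩ := hG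
  refine ⟨hd.add hd', C + C', by positivity, fun z => (norm_add_le _ _).trans ?_⟩
  rw [add_mul, add_mul]
  exact add_le_add (hb z) (hb' z)

theorem const_mul (c : ℂ) (hH : PaleyWienerBound b m H) :
    PaleyWienerBound b m (fun z => c * H z) := by
  obtain ⟨hd, C, hC, hb⟩ := hH
  refine ⟨hd.const_mul c, ‖c‖ * C, by positivity, fun z => ?_⟩
  rw [norm_mul, mul_assoc, mul_assoc, ← mul_assoc C]
  gcongr
  exact hb z

theorem mul (hH : PaleyWienerBound b m H) (hG : PaleyWienerBound b' m' G) :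
    PaleyWienerBound (b + b') (m + m') (fun z => H z * G z) := by
  obtain ⟨hd, C, hC, hb⟩ := hH
  obtain ⟨hd', C', hC', hb'⟩ := hG
  refine ⟨hd.mul hd', C * C', by positivity, fun z => ?_⟩
  have hz : (1 + ‖z‖) ≠ 0 := by positivity
  rw [norm_mul, zpow_add₀ hz, add_mul, Real.exp_add]
  refine (mul_le_mul (hb z) (hb' z) (norm_nonneg _) (by positivity)).trans_eq (by ring)

/-- Division by `z` of a function that vanishes at the origin gains one power of decay. -/
theorem dslope (hH : PaleyWienerBound b m H) (hb0 : 0 ≤ b) (h0 : H 0 = 0) :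
    PaleyWienerBound b (m - 1) (_root_.dslope H 0) := by
  obtain ⟨hd, C, hC, hb⟩ := hH
  have hS : Differentiable ℂ (_root_.dslope H 0) := by
    rw [← differentiableOn_univ, Complex.differentiableOn_dslope univ_mem]
    exact hd.differentiableOn
  have hpos : ∀ z : ℂ, 0 < (1 + ‖z‖) ^ (m - 1) := fun z => by positivity
  have hc : Continuous fun z : ℂ => _root_.dslope H 0 z / (((1 + ‖z‖) ^ (m - 1) : ℝ) : ℂ) := by
    refine hS.continuous.div (Complex.continuous_ofReal.comp ?_)
      fun z => Complex.ofReal_ne_zero.mpr (hpos z).ne'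
    exact (continuous_const.add continuous_norm).zpow₀ _ fun z =>
      Or.inl (show 1 + ‖z‖ ≠ 0 by positivity)
  obtain ⟨D, hD⟩ := (isCompact_closedBall (0 : ℂ) 1).exists_bound_of_continuousOn hc.continuousOn
  refine ⟨hS, max D (2 * C), le_max_of_le_right (by positivity), fun z => ?_⟩
  have hexp : 1 ≤ Real.exp (b * |z.im|) := Real.one_le_exp (by positivity)
  rcases le_total ‖z‖ 1 with hz | hz
  · have h1 := hD z (by simpa using hz)
    rw [norm_div, Complex.norm_real, Real.norm_of_nonneg (hpos z).le, div_le_iff₀ (hpos z)] at h1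
    calc _ ≤ D * (1 + ‖z‖) ^ (m - 1) := h1
      _ ≤ max D (2 * C) * (1 + ‖z‖) ^ (m - 1) := by gcongr; exact le_max_left _ _
      _ ≤ _ := le_mul_of_one_le_right (by positivity) hexp
  · have hz0 : z ≠ 0 := fun h => by rw [h, norm_zero] at hz; linarith
    have hzn : 0 < ‖z‖ := norm_pos_iff.mpr hz0
    rw [dslope_of_ne _ hz0, slope_def_field, h0, sub_zero, sub_zero, norm_div, div_le_iff₀ hzn]
    have h1 : (1 + ‖z‖) ^ m = (1 + ‖z‖) ^ (m - 1) * (1 + ‖z‖) := by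
      rw [← zpow_add_one₀ (by positivity), sub_add_cancel]
    calc ‖H z‖ ≤ C * ((1 + ‖z‖) ^ (m - 1) * (1 + ‖z‖)) * Real.exp (b * |z.im|) := by
          rw [← h1]; exact hb z
      _ ≤ C * ((1 + ‖z‖) ^ (m - 1) * (2 * ‖z‖)) * Real.exp (b * |z.im|) := by gcongr; linarith
      _ = 2 * C * (1 + ‖z‖) ^ (m - 1) * Real.exp (b * |z.im|) * ‖z‖ := by ring
      _ ≤ _ := by gcongr; exact le_max_right _ _

/-- By Cauchy's estimate on unit discs, the Euler operator `z d/dz` costs one power of growth. -/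
theorem mul_deriv {m : ℕ} (hH : PaleyWienerBound b m H) (hb0 : 0 ≤ b) :
    PaleyWienerBound b (m + 1 : ℕ) (fun z => z * deriv H z) := by
  obtain ⟨hd, C, hC, hb⟩ := hH
  refine ⟨differentiable_id.mul hd.deriv, C * 2 ^ m * Real.exp b, by positivity, fun z => ?_⟩
  have h1 : ‖deriv H z‖ ≤ C * (2 * (1 + ‖z‖)) ^ m * Real.exp (b * (|z.im| + 1)) := by
    have := norm_iteratedDeriv_le_of_unit_sphere hd 1 z
      (B := C * (2 * (1 + ‖z‖)) ^ m * Real.exp (b * (|z.im| + 1))) fun w hw => ?_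
    · simpa using this
    · have hw1 : ‖w - z‖ = 1 := by simpa [dist_eq_norm] using hw
      have hw2 : ‖w‖ ≤ ‖z‖ + 1 := by
        have := norm_le_norm_add_norm_sub z w
        rwa [norm_sub_rev, hw1] at this
      have hw3 : |w.im| ≤ |z.im| + 1 := by
        have h2 := (Complex.abs_im_le_norm (w - z)).trans_eq hw1
        rw [Complex.sub_im] at h2
        have := abs_sub_abs_le_abs_sub w.im z.im
        linarith
      refine (hb w).trans ?_
      rw [zpow_natCast]
      gcongr
      linarith [norm_nonneg z]
  rw [norm_mul, zpow_natCast]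
  calc ‖z‖ * ‖deriv H z‖ ≤ (1 + ‖z‖) * (C * (2 * (1 + ‖z‖)) ^ m * Real.exp (b * (|z.im| + 1))) := by
        gcongr; linarith
    _ = _ := by rw [mul_add b, Real.exp_add, mul_pow, mul_one]; ring

end PaleyWienerBound

theorem iteratedDeriv_id_mul_zero {G : ℂ → ℂ} (hG : Differentiable ℂ G) (n : ℕ) :
    iteratedDeriv n (fun z => z * G z) 0 = n * iteratedDeriv (n - 1) G 0 := by
  rw [iteratedDeriv_fun_mul (f := fun z => z) contDiffAt_id hG.contDiff.contDiffAt]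
  rcases n with _ | n
  · simp
  rw [Finset.sum_eq_single 1]
  · simp
  · intro i _ hi
    rcases i with _ | _ | i
    · simp
    · exact absurd rfl hi
    · have : iteratedDeriv (i + 1 + 1) (fun z : ℂ => z) 0 = 0 := by
        rw [iteratedDeriv_succ', deriv_id'', iteratedDeriv_const]
        simp
      rw [this]; simp
  · simp

/-- Multiplication of the `n`-th Taylor coefficient by `∏_{j<k} (n/2 + 1/2 + j)` preserves the
Paley–Wiener type: each factor is the Euler operator up to scaling and a shift. -/
theorem exists_prod_mul_iteratedDeriv {b : ℝ} (hb : 0 ≤ b) {m : ℕ} {F : ℂ → ℂ}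
    (hF : PaleyWienerBound b m F) (k : ℕ) : ∃ H : ℂ → ℂ, PaleyWienerBound b (m + k : ℕ) H ∧
      ∀ n : ℕ, iteratedDeriv n H 0 =
        (∏ j ∈ Finset.range k, ((n : ℂ) / 2 + 1 / 2 + j)) * iteratedDeriv n F 0 := by
  induction k with
  | zero => exact ⟨F, hF, by simp⟩
  | succ k ih =>
    obtain ⟨H, hH, hn⟩ := ih
    refine ⟨fun z => 1 / 2 * (z * deriv H z) + (1 / 2 + k) * H z,
      ((hH.mul_deriv hb).const_mul _).add ((hH.mono (by push_cast; linarith)).const_mul _),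
      fun n => ?_⟩
    have hd := hH.1
    have hc : ContDiff ℂ n H := hd.contDiff
    have hc' : ContDiff ℂ n (fun z => z * deriv H z) := (differentiable_id.mul hd.deriv).contDiff
    rw [iteratedDeriv_fun_add (contDiff_const.mul hc').contDiffAt
        (contDiff_const.mul hc).contDiffAt,
      iteratedDeriv_const_mul_field, iteratedDeriv_const_mul_field,
      iteratedDeriv_id_mul_zero hd.deriv, Finset.prod_range_succ, hn]
    rcases n with _ | n
    · simp; ring
    · rw [Nat.add_sub_cancel, ← iteratedDeriv_succ', hn]
      ring

/-! ### Distributions with prescribed moments -/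

/-- Some distribution supported in `[-b, b]` has the moments `iⁿ H⁽ⁿ⁾(0) ∫ wⁿ⁺ᵠ dρ(w)`. For `q = 0`
and `ρ` the unit mass at `1` this says that `H` is the Fourier transform of a distribution supported
in `[-b, b]`. -/
def RepresentsMoments (ρ : Measure ℝ) (b : ℝ) (q : ℕ) (H : ℂ → ℂ) : Prop :=
  ∃ T : CompactDistribution, Distribution.IsVanishingOn T (Set.Icc (-b) b)ᶜ ∧
    ∀ n : ℕ, T (monomial n) = (∫ w, (w : ℂ) ^ (n + q) ∂ρ) * (Complex.I ^ n * iteratedDeriv n H 0)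

theorem isVanishingOn_integralDistribution {X : Type*} [MeasurableSpace X] (ν : Measure X)
    (h : X → ℂ) (hh : Integrable h ν) (q : X → ℝ) (hq : Measurable q) (b : ℝ)
    (hb : ∀ᵐ p ∂ν, |q p| ≤ b) :
    Distribution.IsVanishingOn (integralDistribution ν h hh q hq b hb) (Set.Icc (-b) b)ᶜ := by
  intro f hf
  rw [integralDistribution_apply]
  refine integral_eq_zero_of_ae ?_
  filter_upwards [hb] with p hp
  have : q p ∉ tsupport f := fun h => hf h (abs_le.mp hp)
  simp [image_eq_zero_of_notMem_tsupport this]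

section

variable {ρ : Measure ℝ} {b : ℝ} {q : ℕ} {H G : ℂ → ℂ}

theorem representsMoments_of_decay [IsFiniteMeasure ρ] (hρ : ∀ᵐ w ∂ρ, |w| ≤ 1)
    (hH : PaleyWienerBound b (-2) H) : RepresentsMoments ρ b q H := by
  obtain ⟨g, hg, hg0, hgm⟩ := exists_density hH
  set ν := (volume.restrict (Set.Icc (-b) b)).prod ρ with hν
  have hw : ∀ᵐ p : ℝ × ℝ ∂ν, |p.2| ≤ 1 := 
    (Measure.quasiMeasurePreserving_snd (μ := volume.restrict (Set.Icc (-b) b)) (ν := ρ)).ae hρ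
  have hx : ∀ᵐ p : ℝ × ℝ ∂ν, |p.1| ≤ b := by
    refine (Measure.quasiMeasurePreserving_fst (μ := volume.restrict (Set.Icc (-b) b)) (ν := ρ)).ae
      (p := fun x => |x| ≤ b) ?_
    filter_upwards [ae_restrict_mem measurableSet_Icc] with x hx using abs_le.mpr hx
  have hi1 : Integrable g (volume.restrict (Set.Icc (-b) b)) :=
    hg.continuousOn.integrableOn_compact isCompact_Icc
  have hi2 : Integrable (fun w : ℝ => (w : ℂ) ^ q) ρ := by
    refine (integrable_const (1 : ℝ)).mono' (by fun_prop) ?_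
    filter_upwards [hρ] with w hw
    rw [norm_pow, Complex.norm_real, Real.norm_eq_abs]
    exact pow_le_one₀ (abs_nonneg _) hw
  have hi : Integrable (fun p : ℝ × ℝ => g p.1 * (p.2 : ℂ) ^ q) ν := hi1.mul_prod hi2
  have hb : ∀ᵐ p : ℝ × ℝ ∂ν, |p.1 * p.2| ≤ b := by
    filter_upwards [hw, hx] with p h1 h2
    rw [abs_mul]
    exact (mul_le_of_le_one_right (abs_nonneg _) h1).trans h2
  refine ⟨integralDistribution ν _ hi (fun p => p.1 * p.2) (by fun_prop) b hb,
    isVanishingOn_integralDistribution _ _ _ _ _ _ hb, fun n => ?_⟩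
  rw [integralDistribution_apply, ← hgm]
  have h1 : ∀ p : ℝ × ℝ, g p.1 * (p.2 : ℂ) ^ q * monomial n (p.1 * p.2)
      = (g p.1 * (p.1 : ℂ) ^ n) * (p.2 : ℂ) ^ (n + q) := fun p => by
    rw [monomial_apply]; push_cast; ring
  simp only [h1]
  rw [hν, integral_prod_mul (fun x : ℝ => g x * (x : ℂ) ^ n) (fun w : ℝ => (w : ℂ) ^ (n + q)),
    setIntegral_eq_integral_of_forall_compl_eq_zero, mul_comm]
  intro x hx
  rw [hg0 x, zero_mul]
  by_contra! h
  exact hx (abs_le.mp h)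

theorem RepresentsMoments.const_mul_add (c : ℂ) (hH : RepresentsMoments ρ b q H)
    (hG : RepresentsMoments ρ b q G) (hHd : Differentiable ℂ H) (hGd : Differentiable ℂ G) :
    RepresentsMoments ρ b q (fun z => c * H z + G z) := by
  obtain ⟨T, hT, hTm⟩ := hH
  obtain ⟨S, hS, hSm⟩ := hG
  refine ⟨c • T + S, fun f hf => ?_, fun n => ?_⟩
  · simp [hT f hf, hS f hf]
  · rw [iteratedDeriv_fun_add (contDiff_const.mul hHd.contDiff).contDiffAt hGd.contDiff.contDiffAt,
      iteratedDeriv_const_mul_field]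
    simp only [_root_.add_apply, _root_.smul_apply, smul_eq_mul, hTm, hSm]
    ring

/-- Multiplication of `H` by `z` corresponds to differentiation of the test function; this lowers
the degree of a monomial, whence the shift of `q`. -/
theorem RepresentsMoments.id_mul (hG : RepresentsMoments ρ b (q + 1) G)
    (hGd : Differentiable ℂ G) : RepresentsMoments ρ b q (fun z => z * G z) := by
  obtain ⟨T, hT, hTm⟩ := hG
  refine ⟨Complex.I • T.comp derivCLM, fun f hf => ?_, fun n => ?_⟩
  · have : tsupport (derivCLM f) ⊆ tsupport f :=
      closure_minimal support_deriv_subset (isClosed_tsupport f)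
    simp [hT _ (this.trans hf)]
  · rw [iteratedDeriv_id_mul_zero hGd]
    simp only [_root_.smul_apply, ContinuousLinearMap.comp_apply, derivCLM_monomial,
      map_smul, smul_eq_mul, hTm]
    rcases n with _ | n
    · simp
    · rw [Nat.add_sub_cancel, show n + 1 + q = n + (q + 1) by ring, pow_succ]
      ring

/-- `|sin(az)| ≤ exp(a|Im z|)`. -/
theorem paleyWienerBound_sin {a : ℝ} (ha : 0 ≤ a) :
    PaleyWienerBound a 0 (fun z => Complex.sin (a * z)) := by
  refine ⟨by fun_prop, 1, zero_le_one, fun z => ?_⟩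
  have h : ∀ s : ℂ, ‖s‖ = 1 → s.re = 0 → ‖Complex.exp (a * z * s)‖ ≤ Real.exp (a * |z.im|) := by
    intro s hs hs0
    have hs1 : |s.im| ≤ 1 := (Complex.abs_im_le_norm s).trans_eq hs
    rw [Complex.norm_exp, Real.exp_le_exp]
    have : (a * z * s).re = -(a * (z.im * s.im)) := by simp [hs0]; ring
    rw [this, ← mul_neg]
    refine mul_le_mul_of_nonneg_left ((neg_le_abs _).trans ?_) ha
    rw [abs_mul]
    exact mul_le_of_le_one_right (abs_nonneg _) hs1
  have h1 := h Complex.I (by simp) (by simp)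
  have h2 := h (-Complex.I) (by simp) (by simp)
  have h3 : Complex.sin (a * z) = (Complex.exp (-(a * z) * Complex.I) -
      Complex.exp (a * z * Complex.I)) * Complex.I / 2 := rfl
  change ‖Complex.sin (a * z)‖ ≤ _
  rw [zpow_zero, mul_one, one_mul, h3, norm_div, norm_mul, Complex.norm_I, mul_one,
    Complex.norm_two, div_le_iff₀ two_pos]
  refine (norm_sub_le _ _).trans ?_
  rw [neg_mul, ← mul_neg]
  linarith

/-- Every function of Paley–Wiener type is represented. One step of the induction writes
`H = c κ + z G`, where `κ` is the square of `sin(bz/2)/z` and `c κ(0) = H(0)`, so that `G` has one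
power of growth less than `H`. Subtracting the constant `H(0)` instead of `c κ` would not do: the
quotient could then decay like `|z|⁻¹`, but not faster. -/
theorem representsMoments_of_paleyWienerBound [IsFiniteMeasure ρ] (hρ : ∀ᵐ w ∂ρ, |w| ≤ 1)
    (hb : 0 < b) (p : ℕ) : ∀ (q : ℕ) (H : ℂ → ℂ), PaleyWienerBound b ((p : ℤ) - 2) H →
      RepresentsMoments ρ b q H := by
  induction p with
  | zero => exact fun q H hH => representsMoments_of_decay hρ (by simpa using hH)
  | succ p ih =>
    intro q H hH
    set σ : ℂ → ℂ := dslope (fun z => Complex.sin ((b / 2 : ℝ) * z)) 0 with hσ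
    have hσb : PaleyWienerBound (b / 2) (0 - 1) σ :=
      (paleyWienerBound_sin (by positivity)).dslope (by positivity) (by simp)
    have hκ : PaleyWienerBound b (-2) (fun z => σ z * σ z) := by
      have := hσb.mul hσb
      rwa [add_halves] at this
    have hσ0 : σ 0 ≠ 0 := by
      have : HasDerivAt (fun z : ℂ => Complex.sin ((b / 2 : ℝ) * z)) ((b / 2 : ℝ) : ℂ) 0 := by
        simpa using ((hasDerivAt_id (0 : ℂ)).const_mul ((b / 2 : ℝ) : ℂ)).csin
      rw [hσ, dslope_same, this.deriv]
      exact Complex.ofReal_ne_zero.mpr (by positivity)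
    set c : ℂ := H 0 / (σ 0 * σ 0) with hc
    have hH₁ : PaleyWienerBound b ((p + 1 : ℕ) - 2 : ℤ) (fun z => H z + -c * (σ z * σ z)) :=
      hH.add ((hκ.const_mul (-c)).mono (by push_cast; linarith))
    have h0 : H 0 + -c * (σ 0 * σ 0) = 0 := by rw [hc]; field_simp; ring
    set G := dslope (fun z => H z + -c * (σ z * σ z)) 0 with hG
    have hGb : PaleyWienerBound b ((p : ℤ) - 2) G := by
      have := hH₁.dslope hb.le h0
      convert this using 1
      push_cast
      ring
    have hHeq : H = fun z => c * (σ z * σ z) + z * G z := by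
      funext z
      have := sub_smul_dslope (fun z => H z + -c * (σ z * σ z)) 0 z
      simp only [sub_zero, smul_eq_mul, h0] at this
      rw [hG, this]
      ring
    rw [hHeq]
    exact (representsMoments_of_decay hρ hκ).const_mul_add c ((ih (q + 1) G hGb).id_mul hGb.1)
      hκ.1 (differentiable_id.mul hGb.1)

end

/-! ### The Paley–Wiener–Schwartz theorem for the Bessel–Struve transform -/

theorem transform_eq_apply_dilation (α : ℝ) (T : CompactDistribution) (lam : ℝ) :
    transform α T lam =
      T (dilation (kernelProfile α) (differentiable_kernelProfile α) (-Complex.I * lam)) := by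
  rw [transform, smoothKernel_eq_dilation]

theorem Gamma_add_natCast_eq_prod {x : ℝ} (hx : 0 < x) (k : ℕ) :
    Real.Gamma (x + k) = (∏ j ∈ Finset.range k, (x + j)) * Real.Gamma x := by
  induction k with
  | zero => simp
  | succ k ih =>
    rw [Nat.cast_succ, ← add_assoc, Real.Gamma_add_one (by positivity), ih, Finset.prod_range_succ]
    ring

/-- The moments of the kernel are inverted, up to the polynomial factor `∏_{j<k} (n/2 + 1/2 + j)`
and a constant, by the moments of another beta distribution. -/
theorem beta_ratio_mul_beta_ratio_mul_prod {α : ℝ} (hα : -1 / 2 < α) {k : ℕ} (hk : α + 1 / 2 < k)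
    (n : ℕ) :
    ProbabilityTheory.beta (1 / 2 + n / 2) (α + 1 / 2) /
        ProbabilityTheory.beta (1 / 2) (α + 1 / 2) *
      (ProbabilityTheory.beta (α + 1 + n / 2) (k - α - 1 / 2) /
        ProbabilityTheory.beta (α + 1) (k - α - 1 / 2)) *
      ∏ j ∈ Finset.range k, ((n : ℝ) / 2 + 1 / 2 + j) = Real.Gamma (1 / 2 + k) / √Real.pi := by
  have hprod := Gamma_add_natCast_eq_prod (show (0 : ℝ) < n / 2 + 1 / 2 by positivity) k
  have hn : (0 : ℝ) ≤ n / 2 := by positivity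
  have h1 : 0 < Real.Gamma ((n : ℝ) / 2 + 1 / 2) := Real.Gamma_pos_of_pos (by positivity)
  have h2 : 0 < Real.Gamma (α + 1 / 2) := Real.Gamma_pos_of_pos (by linarith)
  have h3 : 0 < Real.Gamma (α + 1) := Real.Gamma_pos_of_pos (by linarith)
  have h4 : 0 < Real.Gamma (α + 1 + n / 2) := Real.Gamma_pos_of_pos (by linarith)
  have h5 : 0 < Real.Gamma (k - α - 1 / 2) := Real.Gamma_pos_of_pos (by linarith)
  have h6 : 0 < Real.Gamma (1 / 2 + k) := Real.Gamma_pos_of_pos (by positivity)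
  have h7 : 0 < Real.Gamma ((n : ℝ) / 2 + 1 / 2 + k) := Real.Gamma_pos_of_pos (by positivity)
  have h8 : 0 < √Real.pi := Real.sqrt_pos.mpr Real.pi_pos
  simp only [ProbabilityTheory.beta]
  rw [show (1 : ℝ) / 2 + (α + 1 / 2) = α + 1 by ring,
    show (1 : ℝ) / 2 + n / 2 + (α + 1 / 2) = α + 1 + n / 2 by ring,
    show α + 1 + n / 2 + (k - α - 1 / 2) = n / 2 + 1 / 2 + k by ring,
    show α + 1 + (k - α - 1 / 2) = 1 / 2 + k by ring, add_comm (1 / 2) ((n : ℝ) / 2),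
    Real.Gamma_one_half_eq]
  generalize ∏ j ∈ Finset.range k, ((n : ℝ) / 2 + 1 / 2 + j) = P at *
  generalize Real.Gamma ((n : ℝ) / 2 + 1 / 2) = g₁ at *
  generalize Real.Gamma (α + 1 / 2) = g₂ at *
  generalize Real.Gamma (α + 1) = g₃ at *
  generalize Real.Gamma (α + 1 + n / 2) = g₄ at *
  generalize Real.Gamma (k - α - 1 / 2) = g₅ at *
  generalize Real.Gamma (1 / 2 + k) = g₆ at *
  generalize Real.Gamma ((n : ℝ) / 2 + 1 / 2 + k) = g₇ at *
  field_simp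
  linear_combination -hprod

/-- Every entire function of Paley–Wiener type `b` is the Bessel–Struve transform of a distribution
supported in `[-b, b]`. -/
theorem exists_transform_eq {α : ℝ} (hα : -1 / 2 < α) {b : ℝ} (hb : 0 < b) {m : ℕ} {F : ℂ → ℂ}
    (hF : PaleyWienerBound b m F) : ∃ T : CompactDistribution,
      Distribution.dsupport T ⊆ Set.Icc (-b) b ∧ ∀ lam : ℝ, F lam = transform α T lam := by
  obtain ⟨k, hk⟩ := exists_nat_gt (α + 1 / 2)
  obtain ⟨H, hH, hHF⟩ := exists_prod_mul_iteratedDeriv hb.le hF k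
  have hp : 0 < α + 1 := by linarith
  have hq : 0 < k - α - 1 / 2 := by linarith
  have := isProbabilityMeasure_sqrtBeta hp hq
  obtain ⟨T, hT, hTm⟩ := representsMoments_of_paleyWienerBound (ae_sqrtBeta_abs_le_one _ _) hb
    (m + k + 2) 0 H (by simpa using hH) (ρ := sqrtBeta (α + 1) (k - α - 1 / 2))
  set D : ℝ := Real.Gamma (1 / 2 + k) / √Real.pi with hD
  have hD0 : (D : ℂ) ≠ 0 := by
    have h1 : 0 < Real.Gamma (1 / 2 + k) := Real.Gamma_pos_of_pos (by positivity)
    have h2 : 0 < √Real.pi := Real.sqrt_pos.mpr Real.pi_pos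
    exact Complex.ofReal_ne_zero.mpr (div_pos h1 h2).ne'
  refine ⟨(D : ℂ)⁻¹ • T, Set.sInter_subset_of_mem ⟨fun f hf => ?_, isClosed_Icc⟩, fun lam => ?_⟩
  · simp [hT f hf]
  rw [transform_eq_apply_dilation]
  refine (Complex.hasSum_taylorSeries_of_entire hF.1 0 lam).unique ?_
  have h := hasSum_apply_dilation ((D : ℂ)⁻¹ • T) (hasSum_kernelProfile hα)
    (differentiable_kernelProfile α) (-Complex.I * lam)
  refine (congrArg (HasSum · _) (funext fun n => ?_)).mpr h
  have hc := congrArg ((↑) : ℝ → ℂ) (beta_ratio_mul_beta_ratio_mul_prod hα hk n)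
  rw [← hD, Complex.ofReal_mul, Complex.ofReal_mul] at hc
  have hI : (-Complex.I) ^ n * Complex.I ^ n = 1 := by rw [← mul_pow]; simp
  rw [_root_.smul_apply, hTm, add_zero, integral_pow_sqrtBeta hp hq, hHF, mul_pow, sub_zero,
    smul_eq_mul, smul_eq_mul, smul_eq_mul]
  have hprod : ((∏ j ∈ Finset.range k, ((n : ℝ) / 2 + 1 / 2 + j) : ℝ) : ℂ)
      = ∏ j ∈ Finset.range k, ((n : ℂ) / 2 + 1 / 2 + j) := by push_cast; rfl
  rw [hprod] at hc
  generalize ((ProbabilityTheory.beta (1 / 2 + n / 2) (α + 1 / 2) /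
    ProbabilityTheory.beta (1 / 2) (α + 1 / 2) : ℝ) : ℂ) = c at *
  generalize ((ProbabilityTheory.beta (α + 1 + n / 2) (k - α - 1 / 2) /
    ProbabilityTheory.beta (α + 1) (k - α - 1 / 2) : ℝ) : ℂ) = e at *
  generalize ∏ j ∈ Finset.range k, ((n : ℂ) / 2 + 1 / 2 + j) = Q at *
  have : c / n.factorial * ((-Complex.I) ^ n * (lam : ℂ) ^ n) *
      ((D : ℂ)⁻¹ * (e * (Complex.I ^ n * (Q * iteratedDeriv n F 0))))
      = ((n.factorial : ℂ)⁻¹ * ((lam : ℂ) ^ n * iteratedDeriv n F 0)) *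
        (((-Complex.I) ^ n * Complex.I ^ n) * ((D : ℂ)⁻¹ * (c * e * Q))) := by ring
  rw [this, hI, hc, inv_mul_cancel₀ hD0]
  ring

/-- The transform of a distribution supported in `[-b, b]` extends to an entire function of
Paley–Wiener type `b`. -/
theorem exists_entire_extension_transform {α : ℝ} (hα : -1 / 2 < α) {b : ℝ}
    {T : CompactDistribution} (hT : Distribution.dsupport T ⊆ Set.Icc (-b) b) :
    ∃ F : ℂ → ℂ, Differentiable ℂ F ∧ (∀ x : ℝ, F x = transform α T x) ∧
      ∃ N : ℕ, ∃ C : ℝ, 0 < C ∧ ∀ z, ‖F z‖ ≤ C * (1 + ‖z‖) ^ N * Real.exp (b * |z.im|) := by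
  refine ⟨fun z => T (dilation (kernelProfile α) (differentiable_kernelProfile α)
      (-Complex.I * z)), ?_, fun x => (transform_eq_apply_dilation α T x).symm,
    exists_norm_apply_dilation_le T hT _ (norm_kernelProfile_le hα)⟩
  have h : Differentiable ℂ fun μ : ℂ => T (dilation (kernelProfile α)
      (differentiable_kernelProfile α) μ) := by
    have hs := fun μ => hasSum_apply_dilation T (hasSum_kernelProfile hα)
      (differentiable_kernelProfile α) μ
    simp only [mul_right_comm _ (_ ^ _) (T _)] at hs
    exact differentiable_of_forall_hasSum hs
  exact h.comp (g := fun μ => T (dilation _ _ μ)) (by fun_prop)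

end BesselStruve

end

theorem mainTheorem1 (α : ℝ) (hα : -1 / 2 < α) (b : ℝ) (hb : 0 < b)
    (f : BesselStruve.SmoothSpace) :
    (∃ T : BesselStruve.CompactDistribution,
        Distribution.dsupport T ⊆ Set.Icc (-b) b ∧
        ∀ lam : ℝ, f lam = BesselStruve.transform α T lam) ↔
      ∃ F : ℂ → ℂ, Differentiable ℂ F ∧ (∀ x : ℝ, F x = f x) ∧
        ∃ m : ℕ, ∃ c : ℝ, 0 < c ∧
          ∀ z : ℂ, ‖F z‖ ≤ c * (1 + ‖z‖ ^ 2) ^ ((m : ℝ) / 2) * Real.exp (b * |z.im|) := by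
  have hsq : ∀ (z : ℂ) (m : ℕ), (1 + ‖z‖ ^ 2) ^ ((m : ℝ) / 2) = √(1 + ‖z‖ ^ 2) ^ m := fun z m => by
    rw [Real.sqrt_eq_rpow, ← Real.rpow_mul_natCast (by positivity)]
    ring_nf
  constructor
  · rintro ⟨T, hT, hfT⟩
    obtain ⟨F, hF, hFT, N, C, hC, hb⟩ := BesselStruve.exists_entire_extension_transform hα hT
    refine ⟨F, hF, fun x => (hFT x).trans (hfT x).symm, N, C * 2 ^ N, by positivity,
      fun z => (hb z).trans ?_⟩
    rw [hsq, mul_assoc C (2 ^ N), ← mul_pow]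
    have h : 1 + ‖z‖ ≤ 2 * √(1 + ‖z‖ ^ 2) := by
      have h1 : (1 : ℝ) ≤ √(1 + ‖z‖ ^ 2) := Real.one_le_sqrt.mpr (by linarith [sq_nonneg ‖z‖])
      have h2 : ‖z‖ ≤ √(1 + ‖z‖ ^ 2) := Real.le_sqrt_of_sq_le (by linarith)
      linarith
    gcongr
  · rintro ⟨F, hF, hFf, m, c, hc, hbd⟩
    have hPW : BesselStruve.PaleyWienerBound b m F := by
      refine ⟨hF, c, hc.le, fun z => (hbd z).trans ?_⟩
      rw [hsq, zpow_natCast]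
      have h : √(1 + ‖z‖ ^ 2) ≤ 1 + ‖z‖ :=
        Real.sqrt_le_iff.mpr ⟨by positivity, by nlinarith [norm_nonneg z]⟩
      gcongr
    obtain ⟨T, hT, hFT⟩ := BesselStruve.exists_transform_eq hα hb hPW
    exact ⟨T, hT, fun lam => (hFf lam).symm.trans (hFT lam)⟩
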